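/- A graph $\Gamma$ consists of a set $V(\Gamma)$ of vertices, a set $\vec E(\Gamma)$ of directed edges, a fixed-point-free involution $e\mapsto e^{-1}$ of $\vec E(\Gamma)$ and a terminus map $\tau:\vec E(\Gamma)\to V(\Gamma)$ (so loops and multiple edges are allowed); the edge $e$ runs from $\tau(e^{-1})$ to $\tau(e)$. An isomorphism of graphs is a pair of bijections, on vertices and on directed edges, that commutes with the involutions and the terminus maps. $\Gamma$ is vertex transitive if its automorphism group acts transitively on $V(\Gamma)$, and countable if $V(\Gamma)$ is countable. A partite presentation $P=\langle X\mid \mathcal U\mid\mathcal I\mid\phi\mid\mathcal R\rangle$ consists of a nonempty set $X$ of vertex classes; a set of generators $\mathcal S=\mathcal U\sqcup\mathcal I$, with the associated group $MF_P=\langle \mathcal S\mid s^2,\ s\in\mathcal I\rangle$; a map $\phi:\mathcal S\to \mathrm{Sym}(X)$ such that $\phi(s)$ is a fixed-point-free involution for each $s\in\mathcal I$ and such that the right action of $MF_P$ on $X$ given by $x\cdot s_1\cdots s_n=\phi(s_n)\circ\cdots\circ\phi(s_1)(x)$ (where $s_i\in\mathcal S\cup\mathcal S^{-1}$ and $\phi(s^{-1})=\phi(s)^{-1}$)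 is transitive; and, for each $x\in X$, a set of relators $\mathcal R_x\subseteq \mathrm{Stab}(MF_P,x)$. The presentation graph $C(P)$ has vertex set $X$ and, for each $x\in X$ and each $s\in\mathcal U\cup\mathcal U^{-1}\cup\mathcal I$, one directed edge of colour $s$ from $x$ to $\phi(s)(x)$, whose inverse is the edge of colour $s^{-1}$ from $\phi(s)(x)$ to $x$ (with $s^{-1}=s$ for $s\in\mathcal I$). The partite presentation complex $\mathcal C(P)$ is the 2-complex obtained from $C(P)$ by gluing, for each $x\in X$ and $r\in\mathcal R_x$, a 2-cell along the closed walk that starts at $x$ and follows the edges coloured by the successive letters of the reduced word of $r$. The partite Cayley graph $\mathrm{Sp}(P)$ is the 1-skeleton of the universal cover of $\mathcal C(P)$. Theorem. Every countable, connected, vertex-transitive graph $\Gamma$ has a partite presentation, that is, $\Gamma$ is isomorphic to $\mathrm{Sp}(P)$ for some partite presentation $P$. -/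

import Mathlib

universe u

namespace Partite

/-! ### Graphs -/

/-- A graph in the sense of Gersten: a set of vertices, a set of directed edges, a fixed-point-free
involution `e ↦ e⁻¹` on the directed edges, and a terminus map. Multiple edges and loops are
allowed. -/
structure MGraph : Type (u + 1) where
  V : Type u
  E : Type u
  inv : E → E
  inv_inv : ∀ e, inv (inv e) = e
  inv_ne : ∀ e, inv e ≠ e
  term : E → V

namespace MGraph

/-- The initial vertex of a directed edge. -/
def init (G : MGraph.{u}) (e : G.E) : G.V := G.term (G.inv e)

/-- `G.IsWalk x l`: the directed edges in the list `l` are the consecutive edges of a walk that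
starts at `x`. -/
def IsWalk (G : MGraph.{u}) : G.V → List G.E → Prop
  | _, [] => True
  | x, e :: l => G.init e = x ∧ G.IsWalk (G.term e) l

/-- The last vertex of the walk from `x` along the edges `l`. -/
def endpoint (G : MGraph.{u}) : G.V → List G.E → G.V
  | x, [] => x
  | _, e :: l => G.endpoint (G.term e) l

/-- A graph is connected if it is nonempty and any two vertices are joined by a walk. -/
def Connected (G : MGraph.{u}) : Prop :=
  Nonempty G.V ∧ ∀ x y : G.V, ∃ l, G.IsWalk x l ∧ G.endpoint x l = y

/-- Maps of graphs. -/
structure Hom (G H : MGraph.{u}) where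
  onV : G.V → H.V
  onE : G.E → H.E
  map_inv : ∀ e, onE (G.inv e) = H.inv (onE e)
  map_term : ∀ e, onV (G.term e) = H.term (onE e)

/-- Isomorphisms of graphs: maps of graphs that are bijective on vertices and on directed edges. -/
structure Iso (G H : MGraph.{u}) extends Hom G H where
  bijective_onV : Function.Bijective onV
  bijective_onE : Function.Bijective onE

/-- The automorphism group acts transitively on the vertices. -/
def VertexTransitive (G : MGraph.{u}) : Prop :=
  ∀ x y : G.V, ∃ f : Iso G G, f.onV x = y

theorem isWalk_append (G : MGraph.{u}) (x : G.V) (p q : List G.E) :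
    G.IsWalk x (p ++ q) ↔ G.IsWalk x p ∧ G.IsWalk (G.endpoint x p) q := by
  induction p generalizing x with
  | nil => simp [IsWalk, endpoint]
  | cons e p ih => simp [IsWalk, endpoint, ih, and_assoc]

theorem endpoint_append (G : MGraph.{u}) (x : G.V) (p q : List G.E) :
    G.endpoint x (p ++ q) = G.endpoint (G.endpoint x p) q := by
  induction p generalizing x with
  | nil => rfl
  | cons e p ih => simp [endpoint, ih]

end MGraph

/-! ### Two-dimensional complexes, homotopy of walks, universal covers -/

/-- A (combinatorial) 2-complex: a graph, its 1-skeleton, together with a set of 2-cells; the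
boundary of a 2-cell `f` is glued along the closed walk `bdry f` starting and ending at
`base f`. -/
structure TwoComplex : Type (u + 1) where
  skeleton : MGraph.{u}
  F : Type u
  base : F → skeleton.V
  bdry : F → List skeleton.E
  isWalk_bdry : ∀ f, skeleton.IsWalk (base f) (bdry f)
  endpoint_bdry : ∀ f, skeleton.endpoint (base f) (bdry f) = base f

namespace TwoComplex

/-- The walks in the 1-skeleton starting at `x`. -/
abbrev WalkFrom (C : TwoComplex.{u}) (x : C.skeleton.V) : Type u :=
  {l : List C.skeleton.E // C.skeleton.IsWalk x l}

/-- Elementary homotopies of walks starting at `x`: inserting a pair `e e⁻¹`, or inserting the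
boundary of a 2-cell. -/
inductive Step (C : TwoComplex.{u}) (x : C.skeleton.V) :
    List C.skeleton.E → List C.skeleton.E → Prop
  | backtrack (p q : List C.skeleton.E) (e : C.skeleton.E)
      (h : C.skeleton.init e = C.skeleton.endpoint x p) :
      Step C x (p ++ q) (p ++ ([e, C.skeleton.inv e] ++ q))
  | cell (p q : List C.skeleton.E) (f : C.F)
      (h : C.base f = C.skeleton.endpoint x p) :
      Step C x (p ++ q) (p ++ (C.bdry f ++ q))

/-- Homotopy relative to the endpoints of walks starting at `x`: the equivalence relation generated
by the elementary homotopies. -/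
def homotopy (C : TwoComplex.{u}) (x : C.skeleton.V) : Setoid (C.WalkFrom x) :=
  Relation.EqvGen.setoid fun p q => C.Step x p.1 q.1

/-- A 2-complex is simply connected if it is connected and each closed walk is homotopic to the
trivial walk. -/
def SimplyConnected (C : TwoComplex.{u}) : Prop :=
  C.skeleton.Connected ∧
    ∀ (x : C.skeleton.V) (p : C.WalkFrom x), C.skeleton.endpoint x p.1 = x →
      C.homotopy x p ⟨[], trivial⟩

/-- Cellular maps of 2-complexes. -/
structure Hom (D C : TwoComplex.{u}) extends MGraph.Hom D.skeleton C.skeleton where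
  onF : D.F → C.F
  map_base : ∀ f, onV (D.base f) = C.base (onF f)
  map_bdry : ∀ f, (D.bdry f).map onE = C.bdry (onF f)

/-- A cellular map is a covering map if it is surjective on vertices and, at each vertex `v` of the
source, it is a bijection from the directed edges leaving `v`, and from the 2-cells based at `v`,
to those at the image of `v`. -/
structure Hom.IsCovering {D C : TwoComplex.{u}} (π : Hom D C) : Prop where
  surjective : Function.Surjective π.onV
  edges : ∀ v : D.skeleton.V, Set.BijOn π.onE {e | D.skeleton.init e = v}
    {e | C.skeleton.init e = π.onV v}
  cells : ∀ v : D.skeleton.V, Set.BijOn π.onF {f | D.base f = v} {f | C.base f = π.onV v}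

theorem Step.endpoint_eq {C : TwoComplex.{u}} {x : C.skeleton.V} {p q : List C.skeleton.E}
    (h : C.Step x p q) : C.skeleton.endpoint x p = C.skeleton.endpoint x q := by
  cases h with
  | backtrack p q e h =>
    simp only [MGraph.endpoint_append, MGraph.endpoint]
    rw [← h]; rfl
  | cell p q f h =>
    simp only [MGraph.endpoint_append]
    rw [← h, C.endpoint_bdry]

theorem Step.append {C : TwoComplex.{u}} {x : C.skeleton.V} {p q : List C.skeleton.E}
    (h : C.Step x p q) (r : List C.skeleton.E) : C.Step x (p ++ r) (q ++ r) := by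
  cases h with
  | backtrack p q e h => simpa using Step.backtrack p (q ++ r) e h
  | cell p q f h => simpa using Step.cell p (q ++ r) f h

/-- The vertices of the universal cover: homotopy classes of walks starting at the base
vertex `b`. -/
abbrev CoverV (C : TwoComplex.{u}) (b : C.skeleton.V) : Type u :=
  Quotient (C.homotopy b)

/-- The projection of the universal cover on vertices: the endpoint of a homotopy class. -/
def projV (C : TwoComplex.{u}) (b : C.skeleton.V) : C.CoverV b → C.skeleton.V :=
  Quotient.lift (fun p => C.skeleton.endpoint b p.1) fun p q h => by
    induction h with
    | rel _ _ h => exact h.endpoint_eq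
    | refl => rfl
    | symm _ _ _ ih => exact ih.symm
    | trans _ _ _ _ _ ih₁ ih₂ => exact ih₁.trans ih₂

theorem homotopy_append (C : TwoComplex.{u}) {b : C.skeleton.V} {p q : C.WalkFrom b}
    (h : C.homotopy b p q) (r : List C.skeleton.E)
    (hp : C.skeleton.IsWalk b (p.1 ++ r)) (hq : C.skeleton.IsWalk b (q.1 ++ r)) :
    C.homotopy b ⟨p.1 ++ r, hp⟩ ⟨q.1 ++ r, hq⟩ := by
  have key : ∀ p q : C.WalkFrom b, C.homotopy b p q →
      C.skeleton.endpoint b p.1 = C.skeleton.endpoint b q.1 := fun p q h =>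
    congrArg (C.projV b) (Quotient.sound (s := C.homotopy b) h)
  induction h with
  | rel _ _ h => exact Relation.EqvGen.rel _ _ (h.append r)
  | refl => exact Relation.EqvGen.refl _
  | symm _ _ _ ih => exact Relation.EqvGen.symm _ _ (ih hq hp)
  | trans p q s h₁ _ ih₁ ih₂ =>
    have hm : C.skeleton.IsWalk b (q.1 ++ r) := by
      rw [MGraph.isWalk_append] at hp ⊢
      exact ⟨q.2, key p q h₁ ▸ hp.2⟩
    exact Relation.EqvGen.trans _ _ _ (ih₁ hp hm) (ih₂ hm hq)

/-- Extending a homotopy class `[p]` of walks by a walk `r` that starts at the endpoint of `p`. -/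
def extend (C : TwoComplex.{u}) (b : C.skeleton.V) (v : C.CoverV b) (r : List C.skeleton.E)
    (h : C.skeleton.IsWalk (C.projV b v) r) : C.CoverV b :=
  Quotient.hrecOn (motive := fun v => C.skeleton.IsWalk (C.projV b v) r → C.CoverV b) v
    (fun p h => Quotient.mk (C.homotopy b)
      ⟨p.1 ++ r, (C.skeleton.isWalk_append b p.1 r).2 ⟨p.2, h⟩⟩)
    (fun p q hpq => by
      have e : C.projV b (Quotient.mk (C.homotopy b) p) = C.projV b (Quotient.mk (C.homotopy b) q) :=
        congrArg (C.projV b) (Quotient.sound (s := C.homotopy b) hpq)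
      refine Function.hfunext (by rw [e]) fun h₁ h₂ _ => heq_of_eq ?_
      exact Quotient.sound (s := C.homotopy b) (C.homotopy_append hpq r _ _))
    h

theorem extend_mk (C : TwoComplex.{u}) (b : C.skeleton.V) (p : C.WalkFrom b)
    (r : List C.skeleton.E)
    (h : C.skeleton.IsWalk (C.projV b (Quotient.mk (C.homotopy b) p)) r) :
    C.extend b (Quotient.mk (C.homotopy b) p) r h = Quotient.mk (C.homotopy b)
      ⟨p.1 ++ r, (C.skeleton.isWalk_append b p.1 r).2 ⟨p.2, h⟩⟩ := rfl

theorem projV_extend (C : TwoComplex.{u}) (b : C.skeleton.V) (v : C.CoverV b)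
    (r : List C.skeleton.E) (h : C.skeleton.IsWalk (C.projV b v) r) :
    C.projV b (C.extend b v r h) = C.skeleton.endpoint (C.projV b v) r := by
  induction v using Quotient.inductionOn with
  | _ p => exact C.skeleton.endpoint_append b p.1 r

/-- The directed edges of the universal cover: a vertex of the universal cover together with a
directed edge of `C` leaving its projection. -/
abbrev CoverE (C : TwoComplex.{u}) (b : C.skeleton.V) : Type u :=
  {d : C.CoverV b × C.skeleton.E // C.skeleton.init d.2 = C.projV b d.1}

/-- The terminus of the lift of `e` at `[p]` is `[p e]`. -/
def coverTerm (C : TwoComplex.{u}) (b : C.skeleton.V) (d : C.CoverE b) : C.CoverV b :=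
  C.extend b d.1.1 [d.1.2] ⟨d.2, trivial⟩

theorem projV_coverTerm (C : TwoComplex.{u}) (b : C.skeleton.V) (d : C.CoverE b) :
    C.projV b (C.coverTerm b d) = C.skeleton.term d.1.2 :=
  C.projV_extend b _ _ _

/-- The inverse of the lift of `e` at `[p]` is the lift of `e⁻¹` at `[p e]`. -/
def coverInv (C : TwoComplex.{u}) (b : C.skeleton.V) (d : C.CoverE b) : C.CoverE b :=
  ⟨(C.coverTerm b d, C.skeleton.inv d.1.2), by
    rw [projV_coverTerm, MGraph.init, C.skeleton.inv_inv]⟩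

theorem coverTerm_coverInv (C : TwoComplex.{u}) (b : C.skeleton.V) (d : C.CoverE b) :
    C.coverTerm b (C.coverInv b d) = d.1.1 := by
  obtain ⟨⟨v, e⟩, h⟩ := d
  induction v using Quotient.inductionOn with
  | _ p =>
    refine Quotient.sound (s := C.homotopy b) (Relation.EqvGen.symm _ _ ?_)
    refine Relation.EqvGen.rel _ _ ?_
    have := Step.backtrack (C := C) (x := b) p.1 [] e h
    simpa [coverInv] using this

/-- The 1-skeleton of the universal cover. -/
abbrev coverGraph (C : TwoComplex.{u}) (b : C.skeleton.V) : MGraph.{u} where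
  V := C.CoverV b
  E := C.CoverE b
  inv := C.coverInv b
  inv_inv d := Subtype.ext (Prod.ext (C.coverTerm_coverInv b d) (C.skeleton.inv_inv d.1.2))
  inv_ne d h := C.skeleton.inv_ne d.1.2 (congrArg (fun d => d.1.2) h)
  term := C.coverTerm b

/-- The lift, starting at the vertex `v` of the universal cover, of a walk in `C`. -/
def lift (C : TwoComplex.{u}) (b : C.skeleton.V) : (v : C.CoverV b) → (r : List C.skeleton.E) →
    C.skeleton.IsWalk (C.projV b v) r → List (C.CoverE b)
  | _, [], _ => []
  | v, e :: r, h => ⟨(v, e), h.1⟩ :: C.lift b (C.coverTerm b ⟨(v, e), h.1⟩) r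
      ((C.projV_coverTerm b ⟨(v, e), h.1⟩).symm ▸ h.2)

theorem isWalk_lift (C : TwoComplex.{u}) (b : C.skeleton.V) (v : C.CoverV b)
    (r : List C.skeleton.E) (h : C.skeleton.IsWalk (C.projV b v) r) :
    (C.coverGraph b).IsWalk v (C.lift b v r h) := by
  induction r generalizing v with
  | nil => trivial
  | cons e r ih => exact ⟨C.coverTerm_coverInv b _, ih _ _⟩

theorem endpoint_lift (C : TwoComplex.{u}) (b : C.skeleton.V) (v : C.CoverV b)
    (r : List C.skeleton.E) (h : C.skeleton.IsWalk (C.projV b v) r) :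
    (C.coverGraph b).endpoint v (C.lift b v r h) = C.extend b v r h := by
  induction r generalizing v with
  | nil =>
    induction v using Quotient.inductionOn with
    | _ p => simp [lift, MGraph.endpoint, extend_mk]
  | cons e r ih =>
    refine (ih (C.coverTerm b ⟨(v, e), h.1⟩)
      ((C.projV_coverTerm b ⟨(v, e), h.1⟩).symm ▸ h.2)).trans ?_
    induction v using Quotient.inductionOn with
    | _ p =>
      refine congrArg (Quotient.mk (C.homotopy b)) (Subtype.ext ?_)
      simp

theorem map_lift (C : TwoComplex.{u}) (b : C.skeleton.V) (v : C.CoverV b)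
    (r : List C.skeleton.E) (h : C.skeleton.IsWalk (C.projV b v) r) :
    (C.lift b v r h).map (fun d => d.1.2) = r := by
  induction r generalizing v with
  | nil => rfl
  | cons e r ih => exact congrArg (e :: ·) (ih _ _)

theorem extend_bdry (C : TwoComplex.{u}) (b : C.skeleton.V) (v : C.CoverV b) (f : C.F)
    (hf : C.base f = C.projV b v) (h : C.skeleton.IsWalk (C.projV b v) (C.bdry f)) :
    C.extend b v (C.bdry f) h = v := by
  induction v using Quotient.inductionOn with
  | _ p =>
    refine Quotient.sound (s := C.homotopy b) (Relation.EqvGen.symm _ _ ?_)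
    refine Relation.EqvGen.rel _ _ ?_
    have := Step.cell (C := C) (x := b) p.1 [] f hf
    simpa using this

/-- The universal cover of the connected 2-complex `C` with base vertex `b`: its vertices are the
homotopy classes of walks starting at `b`, and there is one lift of each edge and of each 2-cell
at each vertex over the initial vertex of the edge or over the base vertex of the 2-cell. -/
abbrev universalCover (C : TwoComplex.{u}) (b : C.skeleton.V) : TwoComplex.{u} where
  skeleton := C.coverGraph b
  F := {d : C.CoverV b × C.F // C.base d.2 = C.projV b d.1}
  base d := d.1.1
  bdry d := C.lift b d.1.1 (C.bdry d.1.2) (d.2 ▸ C.isWalk_bdry d.1.2)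
  isWalk_bdry _ := C.isWalk_lift b _ _ _
  endpoint_bdry d := (C.endpoint_lift b _ _ _).trans (C.extend_bdry b _ _ d.2 _)

/-- The covering projection. -/
def universalCoverProj (C : TwoComplex.{u}) (b : C.skeleton.V) : Hom (C.universalCover b) C where
  onV := C.projV b
  onE d := d.1.2
  onF d := d.1.2
  map_inv _ := rfl
  map_term d := C.projV_coverTerm b d
  map_base d := d.2.symm
  map_bdry _ := C.map_lift b _ _ _

theorem universalCoverProj_isCovering (C : TwoComplex.{u}) (b : C.skeleton.V)
    (hC : C.skeleton.Connected) : (C.universalCoverProj b).IsCovering where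
  surjective x := by
    obtain ⟨l, hl, hx⟩ := hC.2 b x
    exact ⟨Quotient.mk (C.homotopy b) ⟨l, hl⟩, hx⟩
  edges v := by
    refine ⟨?_, ?_, ?_⟩
    · rintro d rfl
      exact d.2.trans (congrArg (C.projV b) (C.coverTerm_coverInv b d).symm)
    · intro d hd d' hd' h
      have h₁ : d.1.1 = v := (C.coverTerm_coverInv b d).symm.trans hd
      have h₂ : d'.1.1 = v := (C.coverTerm_coverInv b d').symm.trans hd'
      exact Subtype.ext (Prod.ext (h₁.trans h₂.symm) h)
    · intro e he
      exact ⟨⟨(v, e), he⟩, C.coverTerm_coverInv b _, rfl⟩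
  cells v := by
    refine ⟨?_, ?_, ?_⟩
    · rintro d rfl
      exact d.2
    · intro d hd d' hd' h
      exact Subtype.ext (Prod.ext (Eq.trans hd (Eq.symm hd')) h)
    · intro f hf
      exact ⟨⟨(v, f), hf⟩, rfl, rfl⟩

theorem universalCover_connected (C : TwoComplex.{u}) (b : C.skeleton.V) :
    (C.universalCover b).skeleton.Connected := by
  have fwd : ∀ (v w : C.CoverV b), (∃ l, (C.coverGraph b).IsWalk v l ∧
      (C.coverGraph b).endpoint v l = w) → ∃ l, (C.coverGraph b).IsWalk w l ∧
      (C.coverGraph b).endpoint w l = v := by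
    rintro v w ⟨l, hl, rfl⟩
    induction l generalizing v with
    | nil => exact ⟨[], trivial, rfl⟩
    | cons d l ih =>
      obtain ⟨m, hm, hv⟩ := ih _ hl.2
      refine ⟨m ++ [(C.coverGraph b).inv d], ?_, ?_⟩
      · refine (MGraph.isWalk_append _ _ _ _).2 ⟨hm, ?_, trivial⟩
        refine Eq.trans ?_ hv.symm
        exact congrArg (C.coverGraph b).term ((C.coverGraph b).inv_inv d)
      · refine (MGraph.endpoint_append _ _ _ _).trans ?_
        exact hl.1
  have base : ∀ v : C.CoverV b, ∃ l, (C.coverGraph b).IsWalk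
      (Quotient.mk (C.homotopy b) ⟨[], trivial⟩) l ∧
      (C.coverGraph b).endpoint (Quotient.mk (C.homotopy b) ⟨[], trivial⟩) l = v := by
    intro v
    induction v using Quotient.inductionOn with
    | _ p => exact ⟨C.lift b (Quotient.mk (C.homotopy b) ⟨[], trivial⟩) p.1 p.2,
        C.isWalk_lift b _ _ _, C.endpoint_lift b _ _ _⟩
  refine ⟨⟨Quotient.mk (C.homotopy b) ⟨[], trivial⟩⟩, fun v w => ?_⟩
  obtain ⟨l, hl, hv⟩ := fwd _ _ (base v)
  obtain ⟨m, hm, hw⟩ := base w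
  refine ⟨l ++ m, (MGraph.isWalk_append _ _ _ _).2 ⟨hl, ?_⟩,
    (MGraph.endpoint_append _ _ _ _).trans ?_⟩
  · exact (congrArg (fun t => (C.coverGraph b).IsWalk t m) hv).mpr hm
  · exact (congrArg (fun t => (C.coverGraph b).endpoint t m) hv).trans hw

theorem cancel_left (C : TwoComplex.{u}) (x : C.skeleton.V) (p : List C.skeleton.E)
    (hp : C.skeleton.IsWalk x p) (q : List C.skeleton.E)
    (hq : C.skeleton.IsWalk (C.skeleton.endpoint x p) q)
    (h : C.homotopy x ⟨p ++ q, (C.skeleton.isWalk_append x p q).2 ⟨hp, hq⟩⟩ ⟨p, hp⟩) :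
    C.homotopy (C.skeleton.endpoint x p) ⟨q, hq⟩ ⟨[], trivial⟩ := by
  induction p generalizing x with
  | nil => exact h
  | cons e p ih =>
    refine ih (C.skeleton.term e) hp.2 hq ?_
    have he : C.skeleton.init (C.skeleton.inv e) = C.skeleton.term e := by
      rw [MGraph.init, C.skeleton.inv_inv]
    have hi : C.skeleton.term (C.skeleton.inv e) = x := hp.1
    have lead : ∀ r : C.WalkFrom x,
        C.skeleton.IsWalk (C.skeleton.term e) (C.skeleton.inv e :: r.1) := fun r =>
      ⟨he, hi.symm ▸ r.2⟩
    have step : ∀ r s : C.WalkFrom x, C.homotopy x r s →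
        C.homotopy (C.skeleton.term e) ⟨C.skeleton.inv e :: r.1, lead r⟩
          ⟨C.skeleton.inv e :: s.1, lead s⟩ := by
      intro r s hrs
      induction hrs with
      | rel r s hrs =>
        refine Relation.EqvGen.rel _ _ ?_
        obtain ⟨r, hr⟩ := r
        obtain ⟨s, hs⟩ := s
        change C.Step _ (C.skeleton.inv e :: r) (C.skeleton.inv e :: s)
        change C.Step x r s at hrs
        cases hrs with
        | backtrack p q d h =>
          exact Step.backtrack (C.skeleton.inv e :: p) q d (by rw [h, MGraph.endpoint, hi])
        | cell p q f h =>
          exact Step.cell (C.skeleton.inv e :: p) q f (by rw [h, MGraph.endpoint, hi])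
      | refl => exact Relation.EqvGen.refl _
      | symm _ _ _ ih => exact Relation.EqvGen.symm _ _ ih
      | trans _ _ _ _ _ ih₁ ih₂ => exact Relation.EqvGen.trans _ _ _ ih₁ ih₂
    have red : ∀ (r : List C.skeleton.E) (hr : C.skeleton.IsWalk (C.skeleton.term e) r),
        C.homotopy (C.skeleton.term e) ⟨r, hr⟩
          ⟨C.skeleton.inv e :: e :: r, lead ⟨e :: r, hp.1, hr⟩⟩ := by
      intro r hr
      refine Relation.EqvGen.rel _ _ ?_
      have := Step.backtrack (C := C) (x := C.skeleton.term e) [] r (C.skeleton.inv e) he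
      rw [C.skeleton.inv_inv] at this
      exact this
    exact Relation.EqvGen.trans _ _ _ (red _ _)
      (Relation.EqvGen.trans _ _ _ (step _ _ h) (Relation.EqvGen.symm _ _ (red _ _)))

theorem eq_lift (C : TwoComplex.{u}) (b : C.skeleton.V) (v : C.CoverV b) (L : List (C.CoverE b))
    (hL : (C.coverGraph b).IsWalk v L) :
    ∃ h, L = C.lift b v (L.map fun d => d.1.2) h := by
  induction L generalizing v with
  | nil => exact ⟨trivial, rfl⟩
  | cons d L ih =>
    obtain ⟨⟨w, e⟩, hd⟩ := d
    obtain ⟨h₁, h₂⟩ := hL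
    obtain rfl : w = v := (C.coverTerm_coverInv b ⟨(w, e), hd⟩).symm.trans h₁
    obtain ⟨h, hh⟩ := ih _ h₂
    refine ⟨⟨hd, C.projV_coverTerm b ⟨(w, e), hd⟩ ▸ h⟩, ?_⟩
    exact congrArg _ hh

theorem lift_unique (C : TwoComplex.{u}) (b : C.skeleton.V) {v v' : C.CoverV b}
    {L M : List (C.CoverE b)} (hv : v = v')
    (hL : (C.coverGraph b).IsWalk v L) (hM : (C.coverGraph b).IsWalk v' M)
    (h : L.map (fun d => d.1.2) = M.map fun d => d.1.2) : L = M := by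
  subst hv
  obtain ⟨h₁, e₁⟩ := C.eq_lift b v L hL
  obtain ⟨h₂, e₂⟩ := C.eq_lift b v M hM
  rw [e₁, e₂]
  congr 1

theorem step_lift (C : TwoComplex.{u}) (b : C.skeleton.V) (v : C.CoverV b)
    (L M : List (C.CoverE b)) (hL : (C.coverGraph b).IsWalk v L)
    (hM : (C.coverGraph b).IsWalk v M)
    (h : C.Step (C.projV b v) (L.map fun d => d.1.2) (M.map fun d => d.1.2)) :
    (C.universalCover b).Step v L M := by
  generalize hl : (L.map fun d => d.1.2) = l at h
  generalize hm : (M.map fun d => d.1.2) = m at h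
  cases h with
  | backtrack p q e h =>
    obtain ⟨L₁, L₃, rfl, hL₁, hL₃⟩ := List.map_eq_append_iff.1 hl
    obtain ⟨M₁, M', rfl, hM₁, hM'⟩ := List.map_eq_append_iff.1 hm
    obtain ⟨M₂, M₃, rfl, hM₂, hM₃⟩ := List.map_eq_append_iff.1 hM'
    rw [MGraph.isWalk_append] at hL hM
    obtain rfl : L₁ = M₁ := C.lift_unique b rfl hL.1 hM.1 (hL₁.trans hM₁.symm)
    obtain ⟨d, M₂, rfl, hd, hM₂⟩ := List.map_eq_cons_iff.1 hM₂
    have hM2 := hM.2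
    rw [MGraph.isWalk_append] at hM2
    obtain rfl : M₂ = [(C.coverGraph b).inv d] := by
      refine C.lift_unique b rfl hM2.1.2 ⟨?_, trivial⟩ (hM₂.trans ?_)
      · exact congrArg (C.coverGraph b).term ((C.coverGraph b).inv_inv d)
      · subst hd; rfl
    obtain rfl : L₃ = M₃ :=
      C.lift_unique b (hM2.1.1).symm hL.2 hM2.2 (hL₃.trans hM₃.symm)
    exact Step.backtrack (C := C.universalCover b) L₁ L₃ d hM2.1.1
  | cell p q f h =>
    obtain ⟨L₁, L₃, rfl, hL₁, hL₃⟩ := List.map_eq_append_iff.1 hl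
    obtain ⟨M₁, M', rfl, hM₁, hM'⟩ := List.map_eq_append_iff.1 hm
    obtain ⟨M₂, M₃, rfl, hM₂, hM₃⟩ := List.map_eq_append_iff.1 hM'
    rw [MGraph.isWalk_append] at hL hM
    obtain rfl : L₁ = M₁ := C.lift_unique b rfl hL.1 hM.1 (hL₁.trans hM₁.symm)
    have hM2 := hM.2
    rw [MGraph.isWalk_append] at hM2
    have hw : C.base f = C.projV b ((C.coverGraph b).endpoint v L₁) := by
      obtain ⟨h₁, e₁⟩ := C.eq_lift b v L₁ hL.1
      rw [h, e₁, C.endpoint_lift b, C.projV_extend b, hL₁]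
    let c : (C.universalCover b).F := ⟨((C.coverGraph b).endpoint v L₁, f), hw⟩
    have hc : M₂ = (C.universalCover b).bdry c :=
      C.lift_unique b rfl hM2.1 ((C.universalCover b).isWalk_bdry c)
        (hM₂.trans (C.map_lift b _ _ _).symm)
    obtain rfl : L₃ = M₃ := by
      refine C.lift_unique b ?_ hL.2 hM2.2 (hL₃.trans hM₃.symm)
      rw [hc]
      exact ((C.universalCover b).endpoint_bdry c).symm
    rw [hc]
    exact Step.cell (C := C.universalCover b) L₁ L₃ c rfl

/-- Together with `universalCoverProj_isCovering`: `universalCover` is a simply connected cover. -/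
theorem universalCover_simplyConnected (C : TwoComplex.{u}) (b : C.skeleton.V) :
    (C.universalCover b).SimplyConnected := by
  refine ⟨C.universalCover_connected b, ?_⟩
  intro v L hv
  let o : C.CoverV b := Quotient.mk (C.homotopy b) ⟨[], trivial⟩
  have homot : ∀ p q : C.WalkFrom b, C.homotopy b p q → ∀ L M : (C.universalCover b).WalkFrom o,
      L.1.map (fun d => d.1.2) = p.1 → M.1.map (fun d => d.1.2) = q.1 →
      (C.universalCover b).homotopy o L M := by
    intro p q h
    induction h with
    | rel p q h =>
      intro L M hL hM
      refine Relation.EqvGen.rel _ _ (C.step_lift b o L.1 M.1 L.2 M.2 ?_)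
      rw [hL, hM]
      exact h
    | refl p =>
      intro L M hL hM
      rw [Subtype.ext (C.lift_unique b rfl L.2 M.2 (hL.trans hM.symm))]
    | symm _ _ _ ih => exact fun L M hL hM => Relation.EqvGen.symm _ _ (ih M L hM hL)
    | trans p q r _ _ ih₁ ih₂ =>
      intro L M hL hM
      let N : (C.universalCover b).WalkFrom o := ⟨C.lift b o q.1 q.2, C.isWalk_lift b _ _ _⟩
      exact Relation.EqvGen.trans _ _ _ (ih₁ L N hL (C.map_lift b _ _ _))
        (ih₂ N M (C.map_lift b _ _ _) hM)
  obtain ⟨L, hL⟩ := L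
  induction v using Quotient.inductionOn with
  | _ p =>
    have hK : (C.coverGraph b).IsWalk o (C.lift b o p.1 p.2) := C.isWalk_lift b _ _ _
    have hKe : (C.coverGraph b).endpoint o (C.lift b o p.1 p.2) =
        Quotient.mk (C.homotopy b) p := C.endpoint_lift b _ _ _
    obtain ⟨hr, hLr⟩ := C.eq_lift b _ L hL
    have hcl : C.extend b (Quotient.mk (C.homotopy b) p) (L.map fun d => d.1.2) hr =
        Quotient.mk (C.homotopy b) p :=
      (C.endpoint_lift b _ _ hr).symm.trans (hLr ▸ hv)
    have hpr := Quotient.exact (s := C.homotopy b) hcl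
    have key : ∀ (w : C.CoverV b) (hw : w = Quotient.mk (C.homotopy b) p)
        (hLw : (C.coverGraph b).IsWalk w L),
        (C.universalCover b).homotopy w ⟨L, hLw⟩ ⟨[], trivial⟩ →
        (C.universalCover b).homotopy (Quotient.mk (C.homotopy b) p) ⟨L, hL⟩ ⟨[], trivial⟩ := by
      rintro w rfl _ h
      exact h
    refine key _ hKe (hKe ▸ hL) ((C.universalCover b).cancel_left o _ hK L (hKe ▸ hL) ?_)
    refine homot _ _ hpr _ _ ?_ (C.map_lift b _ _ _)
    exact List.map_append.trans (congrArg (· ++ _) (C.map_lift b o p.1 p.2))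

end TwoComplex

/-! ### Partite presentations -/

/-- The free product of infinite cyclic groups, one for each element of `U`, and of cyclic groups of
order 2, one for each element of `I`: the group `⟨U ∪ I | s² = 1 for s ∈ I⟩`. -/
abbrev MF (U I : Type u) : Type u :=
  PresentedGroup (Set.range fun i : I => (FreeGroup.of (Sum.inr i : U ⊕ I)) ^ 2)

/-- The right action `x · (s₁ ⋯ sₙ) = φ(sₙ) ∘ ⋯ ∘ φ(s₁) (x)` of `MF U I` on `X` defined by a map
`φ` from the generators to the permutations of `X`: following a walk labelled `s₁ ⋯ sₙ`. -/
def action {X U I : Type u} (φ : U ⊕ I → Equiv.Perm X) (h : ∀ i, φ (Sum.inr i) ^ 2 = 1) :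
    MF U I →* (Equiv.Perm X)ᵐᵒᵖ :=
  PresentedGroup.toGroup (f := fun s => MulOpposite.op (φ s)) (by
    rintro _ ⟨i, rfl⟩
    simp [← MulOpposite.op_pow, h])

/-- A partite presentation `⟨X | U | I | φ | R⟩`. -/
structure PartitePresentation : Type (u + 1) where
  /-- the vertex classes -/
  X : Type u
  /-- the generators are the elements of the disjoint union of `U` and `I` -/
  U : Type u
  I : Type u
  φ : U ⊕ I → Equiv.Perm X
  nonempty : Nonempty X
  sq_eq_one : ∀ i : I, φ (Sum.inr i) ^ 2 = 1
  fixedPointFree : ∀ (i : I) (x : X), φ (Sum.inr i) x ≠ x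
  transitive : ∀ x y : X, ∃ w : MF U I, (action φ sq_eq_one w).unop x = y
  /-- the relator sets -/
  R : X → Set (MF U I)
  stab : ∀ x, ∀ r ∈ R x, (action φ sq_eq_one r).unop x = x

/-- The letters: the elements of `U ∪ U⁻¹ ∪ I`. -/
inductive Letter (U I : Type u) : Type u
  | pos (s : U)
  | neg (s : U)
  | invol (s : I)

namespace Letter

def inv {U I : Type u} : Letter U I → Letter U I
  | pos s => neg s
  | neg s => pos s
  | invol s => invol s

/-- The element of the group `MF U I` given by a letter. -/
def toMF {U I : Type u} : Letter U I → MF U I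
  | pos s => PresentedGroup.of (Sum.inl s)
  | neg s => (PresentedGroup.of (Sum.inl s))⁻¹
  | invol s => PresentedGroup.of (Sum.inr s)

/-- A word is reduced if no letter in it is followed by its inverse. Each element of `MF U I` is
represented by exactly one reduced word. -/
def Reduced {U I : Type u} (w : List (Letter U I)) : Prop :=
  w.IsChain fun a b => b ≠ a.inv

end Letter

namespace PartitePresentation

/-- The permutation `φ(s)` for `s ∈ U ∪ U⁻¹ ∪ I`, with `φ(s⁻¹) = φ(s)⁻¹`. -/
def perm (P : PartitePresentation.{u}) : Letter P.U P.I → Equiv.Perm P.X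
  | .pos s => P.φ (Sum.inl s)
  | .neg s => (P.φ (Sum.inl s))⁻¹
  | .invol s => P.φ (Sum.inr s)

theorem perm_inv (P : PartitePresentation.{u}) (s : Letter P.U P.I) (x : P.X) :
    P.perm s.inv (P.perm s x) = x := by
  cases s with
  | pos s => simp [perm, Letter.inv]
  | neg s => simp [perm, Letter.inv]
  | invol s =>
    have := congrArg (fun f => f x) (P.sq_eq_one s)
    simpa [perm, Letter.inv, pow_two] using this

theorem action_toMF (P : PartitePresentation.{u}) (s : Letter P.U P.I) :
    (action P.φ P.sq_eq_one s.toMF).unop = P.perm s := by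
  cases s <;> simp [action, Letter.toMF, perm]

/-- The presentation graph: its vertex set is `X`, and for each `x ∈ X` and `s ∈ U ∪ U⁻¹ ∪ I` there
is a directed edge `(x, s)` of colour `s` from `x` to `φ(s)(x)`, whose inverse is the edge
`(φ(s)(x), s⁻¹)`. -/
abbrev graph (P : PartitePresentation.{u}) : MGraph.{u} where
  V := P.X
  E := P.X × Letter P.U P.I
  term e := P.perm e.2 e.1
  inv e := (P.perm e.2 e.1, e.2.inv)
  inv_inv := by
    rintro ⟨x, s⟩
    refine Prod.ext (P.perm_inv s x) ?_
    cases s <;> rfl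
  inv_ne := by
    rintro ⟨x, s⟩ h
    cases s with
    | pos s => exact Letter.noConfusion rfl rfl (heq_of_eq (congrArg Prod.snd h))
    | neg s => exact Letter.noConfusion rfl rfl (heq_of_eq (congrArg Prod.snd h))
    | invol s => exact P.fixedPointFree s x (congrArg Prod.fst h)

/-- The walk in the presentation graph that starts at `x` and is dictated by the word `w`. -/
def walk (P : PartitePresentation.{u}) : P.X → List (Letter P.U P.I) → List (P.X × Letter P.U P.I)
  | _, [] => []
  | x, s :: w => (x, s) :: P.walk (P.perm s x) w

theorem isWalk_walk (P : PartitePresentation.{u}) (x : P.X) (w : List (Letter P.U P.I)) :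
    P.graph.IsWalk x (P.walk x w) := by
  induction w generalizing x with
  | nil => trivial
  | cons s w ih => exact ⟨P.perm_inv s x, ih _⟩

theorem endpoint_walk (P : PartitePresentation.{u}) (x : P.X) (w : List (Letter P.U P.I)) :
    P.graph.endpoint x (P.walk x w) =
      (action P.φ P.sq_eq_one (w.map Letter.toMF).prod).unop x := by
  induction w generalizing x with
  | nil =>
    simp only [walk, MGraph.endpoint, List.map_nil, List.prod_nil, map_one]
    rfl
  | cons s w ih =>
    refine (ih (P.perm s x)).trans ?_
    rw [← P.action_toMF, List.map_cons, List.prod_cons, map_mul]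
    rfl

/-- The partite presentation complex: for each `x ∈ X` and each relator `r ∈ R x`, a 2-cell is glued
to the presentation graph along the walk starting at `x` and dictated by (the reduced word of)
`r`. -/
abbrev complex (P : PartitePresentation.{u}) : TwoComplex.{u} where
  skeleton := P.graph
  F := {c : P.X × List (Letter P.U P.I) // Letter.Reduced c.2 ∧ (c.2.map Letter.toMF).prod ∈ P.R c.1}
  base c := c.1.1
  bdry c := P.walk c.1.1 c.1.2
  isWalk_bdry _ := P.isWalk_walk _ _
  endpoint_bdry c := (P.endpoint_walk _ _).trans (P.stab _ _ c.2.2)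

/-- The partite Cayley graph of `P`: the 1-skeleton of the universal cover of the partite
presentation complex, constructed with base vertex `b`. -/
def cayleyGraph (P : PartitePresentation.{u}) (b : P.X) : MGraph.{u} :=
  (P.complex.universalCover b).skeleton

end PartitePresentation

end Partite

/-
If all the relator sets are the full stabilizers, the partite presentation complex is simply
connected, so the partite Cayley graph is the presentation graph. It remains to colour the directed
edges so that each vertex is the initial vertex of exactly one edge of each colour and the colour of
`e` determines that of `e⁻¹`.

This can be done separately for the loops and for the edges of each multiplicity. Colours of loops
are transported by automorphisms. Edges of constant multiplicity are coloured by an edge of the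
underlying simple graph and a label, so let this graph be simple. If its degree is infinite, it is a
countable union of disjoint perfect matchings, built edge by edge. If its degree is even, orient it
with equal in- and outdegrees; by Hall's theorem, the arcs split into permutations of the vertices.
If its degree `d` is odd, remove a perfect matching: a finite set with nonempty edge boundary has at
least `d` boundary edges, so Tutte's condition holds near any finite set, and perfect matchings
near finite sets are glued by compactness.
-/

namespace Partite

section BipartiteMultigraph

variable {D A B : Type*}

theorem exists_injective_of_regular (src : D → A) (tgt : D → B) {n : ℕ} (hn : n ≠ 0)
    (hs : ∀ a, (src ⁻¹' {a}).encard = n) (ht : ∀ b, (tgt ⁻¹' {b}).encard = n) :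
    ∃ f : A → B, Function.Injective f ∧ ∀ a, ∃ d, src d = a ∧ tgt d = f a := by
  classical
  have finite_src (a : A) : (src ⁻¹' {a}).Finite := Set.finite_of_encard_eq_coe (hs a)
  have finite_tgt (b : B) : (tgt ⁻¹' {b}).Finite := Set.finite_of_encard_eq_coe (ht b)
  have card_src (a : A) : (finite_src a).toFinset.card = n := by
    rw [← Nat.cast_inj (R := ℕ∞), ← (finite_src a).encard_eq_coe_toFinset_card, hs a]
  have card_tgt (b : B) : (finite_tgt b).toFinset.card = n := by
    rw [← Nat.cast_inj (R := ℕ∞), ← (finite_tgt b).encard_eq_coe_toFinset_card, ht b]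
  let neighbours (a : A) : Finset B := (finite_src a).toFinset.image tgt
  have hall (S : Finset A) : S.card ≤ (S.biUnion neighbours).card := by
    refine Nat.le_of_mul_le_mul_right ?_ (Nat.pos_of_ne_zero hn)
    calc S.card * n = (S.biUnion fun a => (finite_src a).toFinset).card := by
          rw [Finset.card_biUnion]
          · simp only [card_src, Finset.sum_const, smul_eq_mul]
          · refine fun a _ a' _ hne => Finset.disjoint_left.2 fun d hd hd' => hne ?_
            simp only [Set.Finite.mem_toFinset, Set.mem_preimage, Set.mem_singleton_iff] at hd hd'
            exact hd.symm.trans hd'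
      _ ≤ ((S.biUnion neighbours).biUnion fun b => (finite_tgt b).toFinset).card := by
          refine Finset.card_le_card fun d hd => ?_
          simp only [neighbours, Finset.mem_biUnion, Set.Finite.mem_toFinset, Set.mem_preimage,
            Set.mem_singleton_iff, Finset.mem_image] at hd ⊢
          obtain ⟨a, ha, hd⟩ := hd
          exact ⟨tgt d, ⟨a, ha, d, hd, rfl⟩, rfl⟩
      _ ≤ (S.biUnion neighbours).card * n :=
          Finset.card_biUnion_le_card_mul _ _ n fun b _ => (card_tgt b).le
  obtain ⟨f, hf, hfmem⟩ := (Finset.all_card_le_biUnion_card_iff_exists_injective neighbours).1 hall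
  exact ⟨f, hf, fun a => by simpa [neighbours] using hfmem a⟩

theorem exists_bijOn_of_regular (src : D → A) (tgt : D → B) {n : ℕ} (hn : n ≠ 0)
    (hs : ∀ a, (src ⁻¹' {a}).encard = n) (ht : ∀ b, (tgt ⁻¹' {b}).encard = n) :
    ∃ M : Set D, Set.BijOn src M Set.univ ∧ Set.BijOn tgt M Set.univ := by
  obtain ⟨f, hf, hfd⟩ := exists_injective_of_regular src tgt hn hs ht
  obtain ⟨g, hg, hgd⟩ := exists_injective_of_regular tgt src hn ht hs
  obtain ⟨h, hbij, hjoined⟩ := Function.Embedding.schroeder_bernstein_of_rel hf hg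
    (fun a b => ∃ d, src d = a ∧ tgt d = b) hfd (fun b => (hgd b).imp fun _ => And.symm)
  choose m src_m tgt_m using hjoined
  have src_comp : src ∘ m = id := funext src_m
  have tgt_comp : tgt ∘ m = h := funext tgt_m
  have m_injOn : Set.InjOn m Set.univ := (Function.LeftInverse.injective src_m).injOn
  refine ⟨m '' Set.univ, (Set.bijOn_comp_iff m_injOn).1 ?_, (Set.bijOn_comp_iff m_injOn).1 ?_⟩
  · exact src_comp ▸ Function.bijective_id.bijOn_univ
  · exact tgt_comp ▸ hbij.bijOn_univ

theorem encard_preimage_domRestrict_compl {T : Type*} {f : D → T} {M : Set D} {n : ℕ} {t : T}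
    (hM : Set.BijOn f M Set.univ) (hf : (f ⁻¹' {t}).encard = (n + 1 : ℕ)) :
    (Mᶜ.domRestrict f ⁻¹' {t}).encard = n := by
  obtain ⟨d, hd, hdt⟩ := hM.surjOn (Set.mem_univ t)
  have image_eq : Subtype.val '' (Mᶜ.domRestrict f ⁻¹' {t}) = f ⁻¹' {t} \ {d} := by
    ext e
    constructor
    · rintro ⟨⟨e, he⟩, het, rfl⟩
      exact ⟨het, fun h : e = d => he (h ▸ hd)⟩
    · rintro ⟨het, hne⟩
      exact ⟨⟨e, fun he => hne (hM.injOn he hd (het.trans hdt.symm))⟩, het, rfl⟩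
  rw [← Subtype.val_injective.encard_image, image_eq,
    Set.encard_sdiff_singleton_of_mem (Set.mem_preimage.2 hdt), hf]
  norm_cast

open Classical in
theorem bijective_prodMk_of_bijOn {T : Type*} {f : D → T} {M : Set D} {n : ℕ} {col : ↥Mᶜ → Fin n}
    (hM : Set.BijOn f M Set.univ) (hcol : Function.Bijective fun d => (Mᶜ.domRestrict f d, col d)) :
    Function.Bijective fun d => (f d, if h : d ∈ Mᶜ then (col ⟨d, h⟩).succ else 0) := by
  constructor
  · intro d d' h
    obtain ⟨hf, hc⟩ := Prod.mk.inj h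
    by_cases hd : d ∈ Mᶜ <;> by_cases hd' : d' ∈ Mᶜ
    · rw [dif_pos hd, dif_pos hd', Fin.succ_inj] at hc
      exact congrArg Subtype.val (@hcol.1 ⟨d, hd⟩ ⟨d', hd'⟩ (Prod.ext hf hc))
    · exact absurd hc (by simp only [dif_pos hd, dif_neg hd', Fin.succ_ne_zero, not_false_iff])
    · exact absurd hc.symm (by simp only [dif_pos hd', dif_neg hd, Fin.succ_ne_zero, not_false_iff])
    · exact hM.injOn (not_not.1 hd) (not_not.1 hd') hf
  · rintro ⟨t, i⟩
    induction i using Fin.cases with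
    | zero =>
      obtain ⟨d, hd, rfl⟩ := hM.surjOn (Set.mem_univ t)
      exact ⟨d, Prod.ext rfl (dif_neg fun h => h hd)⟩
    | succ i =>
      obtain ⟨⟨d, hd⟩, h⟩ := hcol.2 (t, i)
      obtain ⟨rfl, rfl⟩ := Prod.mk.inj h
      exact ⟨d, Prod.ext rfl (dif_pos hd)⟩

theorem exists_colouring_of_regular (n : ℕ) : ∀ {D : Type*} (src : D → A) (tgt : D → B),
    (∀ a, (src ⁻¹' {a}).encard = n) → (∀ b, (tgt ⁻¹' {b}).encard = n) →
    ∃ col : D → Fin n, (Function.Bijective fun d => (src d, col d)) ∧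
      Function.Bijective fun d => (tgt d, col d) := by
  induction n with
  | zero =>
    intro D src tgt hs _
    have : IsEmpty D :=
      ⟨fun d => Set.notMem_empty d (Set.encard_eq_zero.1 (hs (src d)) ▸ rfl)⟩
    refine ⟨isEmptyElim, ⟨isEmptyElim, ?_⟩, ⟨isEmptyElim, ?_⟩⟩ <;> exact fun x => x.2.elim0
  | succ n ih =>
    intro D src tgt hs ht
    obtain ⟨M, hMs, hMt⟩ := exists_bijOn_of_regular src tgt n.succ_ne_zero hs ht
    obtain ⟨col, hcs, hct⟩ := ih (Mᶜ.domRestrict src) (Mᶜ.domRestrict tgt)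
      (fun a => encard_preimage_domRestrict_compl hMs (hs a))
      (fun b => encard_preimage_domRestrict_compl hMt (ht b))
    exact ⟨_, bijective_prodMk_of_bijOn hMs hcs, bijective_prodMk_of_bijOn hMt hct⟩

end BipartiteMultigraph

section EdgeConnectivity

theorem map_neighborFinset {V : Type*} {G : SimpleGraph V} [G.LocallyFinite] (σ : G ≃g G) (x : V) :
    (G.neighborFinset x).map σ.toEquiv.toEmbedding = G.neighborFinset (σ x) := by
  ext y
  rw [Finset.mem_map_equiv, SimpleGraph.mem_neighborFinset, SimpleGraph.mem_neighborFinset,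
    ← σ.map_adj_iff]
  exact iff_of_eq (congrArg _ (σ.toEquiv.apply_symm_apply y))

variable {V : Type*} [DecidableEq V] (G : SimpleGraph V) [G.LocallyFinite]

/-- The edge boundary of a finite set of vertices: the arcs `⟨x, y⟩` that leave it. -/
def outArcs (A : Finset V) : Finset (Σ _ : V, V) :=
  A.sigma fun x => G.neighborFinset x \ A

variable {G}

theorem mem_outArcs {A : Finset V} {a : Σ _ : V, V} :
    a ∈ outArcs G A ↔ a.1 ∈ A ∧ G.Adj a.1 a.2 ∧ a.2 ∉ A := by
  simp only [outArcs, Finset.mem_sigma, Finset.mem_sdiff, SimpleGraph.mem_neighborFinset]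

theorem card_outArcs_sdiff_le (A B : Finset V) :
    (outArcs G (A \ B)).card ≤
      ((outArcs G A).filter fun a => a.1 ∉ B).card +
        ((outArcs G B).filter fun a => a.1 ∈ A).card := by
  have subset : outArcs G (A \ B) ⊆ (outArcs G A).filter (fun a => a.1 ∉ B) ∪
      ((outArcs G B).filter fun a => a.1 ∈ A).image fun a => ⟨a.2, a.1⟩ := by
    rintro ⟨x, y⟩ h
    simp only [Finset.mem_union, Finset.mem_filter, Finset.mem_image, mem_outArcs,
      Finset.mem_sdiff] at h ⊢
    obtain ⟨⟨hxA, hxB⟩, hxy, hy⟩ := h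
    by_cases hyA : y ∈ A
    · exact .inr ⟨⟨y, x⟩, ⟨⟨by tauto, hxy.symm, hxB⟩, hyA⟩, rfl⟩
    · exact .inl ⟨⟨hxA, hxy, hyA⟩, hxB⟩
  exact (Finset.card_le_card subset).trans ((Finset.card_union_le _ _).trans
    (Nat.add_le_add_left Finset.card_image_le _))

theorem card_outArcs_sdiff_add_card_outArcs_sdiff_le (A B : Finset V) :
    (outArcs G (A \ B)).card + (outArcs G (B \ A)).card ≤
      (outArcs G A).card + (outArcs G B).card := by
  have hAB := card_outArcs_sdiff_le (G := G) A B
  have hBA := card_outArcs_sdiff_le (G := G) B A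
  have hA := Finset.card_filter_add_card_filter_not (s := outArcs G A) fun a => a.1 ∈ B
  have hB := Finset.card_filter_add_card_filter_not (s := outArcs G B) fun a => a.1 ∈ A
  omega

theorem card_outArcs_map (σ : G ≃g G) (A : Finset V) :
    (outArcs G (A.map σ.toEquiv.toEmbedding)).card = (outArcs G A).card := by
  simp only [outArcs, Finset.card_sigma, Finset.sum_map]
  refine Finset.sum_congr rfl fun x _ => ?_
  change (G.neighborFinset (σ x) \ _).card = _
  rw [← map_neighborFinset, ← Finset.map_sdiff, Finset.card_map]

/-- An atom for edge connectivity: among the finite sets of vertices with nonempty edge boundary it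
has the smallest boundary and, subject to that, the fewest elements. -/
structure IsEdgeAtom (G : SimpleGraph V) [G.LocallyFinite] (A : Finset V) : Prop where
  nonempty : (outArcs G A).Nonempty
  card_le : ∀ B, (outArcs G B).Nonempty → (outArcs G A).card ≤ (outArcs G B).card
  card_lt : ∀ B, (outArcs G B).Nonempty → B.card < A.card →
    (outArcs G A).card < (outArcs G B).card

theorem exists_isEdgeAtom {B : Finset V} (hB : (outArcs G B).Nonempty) :
    ∃ A, IsEdgeAtom G A := by
  obtain ⟨A, hA, hmin⟩ := exists_minimalFor_of_wellFoundedLT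
    (fun A => (outArcs G A).Nonempty) (fun A => toLex ((outArcs G A).card, A.card)) ⟨B, hB⟩
  have le_lex (C) (hC : (outArcs G C).Nonempty) :
      toLex ((outArcs G A).card, A.card) ≤ toLex ((outArcs G C).card, C.card) :=
    le_of_not_gt fun h => h.not_ge (hmin hC h.le)
  simp only [Prod.Lex.toLex_le_toLex] at le_lex
  refine ⟨A, hA, fun C hC => ?_, fun C hC hcard => ?_⟩ <;> have := le_lex C hC <;> omega

theorem IsEdgeAtom.map {A : Finset V} (hA : IsEdgeAtom G A) (σ : G ≃g G) :
    IsEdgeAtom G (A.map σ.toEquiv.toEmbedding) where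
  nonempty := by
    rw [← Finset.card_pos, card_outArcs_map]
    exact hA.nonempty.card_pos
  card_le B hB := by
    rw [card_outArcs_map]
    exact hA.card_le B hB
  card_lt B hB hcard := by
    rw [card_outArcs_map]
    exact hA.card_lt B hB (hcard.trans_eq (Finset.card_map σ.toEquiv.toEmbedding))

theorem IsEdgeAtom.outArcs_nonempty_of_subset {A C : Finset V} (hA : IsEdgeAtom G A) (hCA : C ⊆ A)
    (hC : C.Nonempty) : (outArcs G C).Nonempty := by
  by_contra hempty
  rw [Finset.not_nonempty_iff_eq_empty] at hempty
  have outArcs_sdiff : outArcs G (A \ C) = outArcs G A := by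
    have not_mem (x y : V) : ¬ (x ∈ C ∧ G.Adj x y ∧ y ∉ C) := fun h =>
      Finset.notMem_empty (⟨x, y⟩ : Σ _ : V, V) (hempty ▸ mem_outArcs.2 h)
    ext ⟨x, y⟩
    have := not_mem x y
    have := not_mem y x
    have := @hCA x
    have := @hCA y
    simp only [mem_outArcs, Finset.mem_sdiff, G.adj_comm y x] at *
    tauto
  have hlt := hA.card_lt (A \ C) (outArcs_sdiff ▸ hA.nonempty)
    (Finset.card_lt_card (Finset.sdiff_ssubset hCA hC))
  exact hlt.ne (congrArg _ outArcs_sdiff.symm)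

theorem IsEdgeAtom.lt_card_outArcs_sdiff {A B : Finset V} (hA : IsEdgeAtom G A)
    (hcard : B.card = A.card) (hne : A ≠ B) (hAB : ¬ Disjoint A B) :
    (outArcs G A).card < (outArcs G (A \ B)).card := by
  refine hA.card_lt _ (hA.outArcs_nonempty_of_subset Finset.sdiff_subset ?_) ?_
  · rw [Finset.sdiff_nonempty]
    exact fun hsub => hne (Finset.eq_of_subset_of_card_le hsub hcard.le)
  · refine Finset.card_lt_card (Finset.sdiff_subset.ssubset_of_ne fun h => hAB ?_)
    exact Finset.sdiff_eq_self_iff_disjoint.1 h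

/-- Edge atoms are blocks of imprimitivity of the automorphism group, because the boundary is
posimodular. -/
theorem IsEdgeAtom.map_eq_of_not_disjoint {A : Finset V} (hA : IsEdgeAtom G A) (σ : G ≃g G)
    (hσ : ¬ Disjoint A (A.map σ.toEquiv.toEmbedding)) : A.map σ.toEquiv.toEmbedding = A := by
  by_contra hne
  have hcard := Finset.card_map σ.toEquiv.toEmbedding (s := A)
  have hlt := hA.lt_card_outArcs_sdiff hcard (Ne.symm hne) hσ
  have hlt' := (hA.map σ).lt_card_outArcs_sdiff hcard.symm hne fun h => hσ h.symm
  have := card_outArcs_sdiff_add_card_outArcs_sdiff_le (G := G) A (A.map σ.toEquiv.toEmbedding)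
  omega

theorem IsEdgeAtom.card_neighborFinset_inter {A : Finset V} (hA : IsEdgeAtom G A)
    (ht : ∀ x y, ∃ σ : G ≃g G, σ x = y) {x y : V} (hx : x ∈ A) (hy : y ∈ A) :
    (G.neighborFinset x ∩ A).card = (G.neighborFinset y ∩ A).card := by
  obtain ⟨σ, rfl⟩ := ht x y
  have map_eq : A.map σ.toEquiv.toEmbedding = A := hA.map_eq_of_not_disjoint σ
    (Finset.not_disjoint_iff.2 ⟨σ x, hy, Finset.mem_map_of_mem σ.toEquiv.toEmbedding hx⟩)
  rw [← map_neighborFinset, ← Finset.card_map σ.toEquiv.toEmbedding, Finset.map_inter, map_eq]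

/-- **Mader's theorem**: vertex-transitive graphs of degree `d` are `d`-edge-connected. -/
theorem le_card_outArcs (ht : ∀ x y, ∃ σ : G ≃g G, σ x = y) {d : ℕ}
    (hd : G.IsRegularOfDegree d) {B : Finset V} (hB : (outArcs G B).Nonempty) :
    d ≤ (outArcs G B).card := by
  obtain ⟨A, hA⟩ := exists_isEdgeAtom hB
  refine le_trans ?_ (hA.card_le B hB)
  obtain ⟨⟨x, y⟩, hxy⟩ := hA.nonempty
  obtain ⟨hx, hadj, hy⟩ : x ∈ A ∧ G.Adj x y ∧ y ∉ A := mem_outArcs.1 hxy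
  have degree_eq (z : V) :
      (G.neighborFinset z ∩ A).card + (G.neighborFinset z \ A).card = d := by
    rw [Finset.card_inter_add_card_sdiff, SimpleGraph.card_neighborFinset_eq_degree, hd z]
  have card_out (z : V) (hz : z ∈ A) :
      (G.neighborFinset z \ A).card = (G.neighborFinset x \ A).card := by
    have := degree_eq x
    have := degree_eq z
    have := hA.card_neighborFinset_inter ht hz hx
    omega
  have card_outArcs_eq : (outArcs G A).card = A.card * (G.neighborFinset x \ A).card := by
    rw [outArcs, Finset.card_sigma, Finset.sum_congr rfl card_out, Finset.sum_const, smul_eq_mul]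
  have card_in_lt : (G.neighborFinset x ∩ A).card < A.card := by
    refine Finset.card_lt_card (Finset.inter_subset_right.ssubset_of_ne fun h => ?_)
    exact G.notMem_neighborFinset_self x (Finset.mem_inter.1 (h ▸ hx)).1
  have out_pos : 0 < (G.neighborFinset x \ A).card :=
    Finset.card_pos.2 ⟨y, Finset.mem_sdiff.2 ⟨(G.mem_neighborFinset x y).2 hadj, hy⟩⟩
  have := degree_eq x
  rw [card_outArcs_eq]
  nlinarith

end EdgeConnectivity

section PerfectMatching

theorem exists_superset_even_card {V : Type*} (hV : Finite V → Even (Nat.card V)) (F : Finset V) :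
    ∃ N, F ⊆ N ∧ Even N.card := by
  classical
  obtain hfin | hinf := finite_or_infinite V
  · have := Fintype.ofFinite V
    exact ⟨Finset.univ, F.subset_univ, by simpa using hV hfin⟩
  · obtain hF | hF := Nat.even_or_odd F.card
    · exact ⟨F, subset_rfl, hF⟩
    · obtain ⟨x, hx⟩ := Infinite.exists_notMem_finset F
      exact ⟨insert x F, F.subset_insert x, Finset.card_insert_of_notMem hx ▸ hF.add_one⟩

theorem subsingleton_connectedComponents_inter {W : Type*} {K : SimpleGraph W} {s : Set W}
    (hs : K.IsClique s) : {c : K.ConnectedComponent | (c.supp ∩ s).Nonempty}.Subsingleton := by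
  rintro c ⟨x, rfl, hx⟩ c' ⟨y, rfl, hy⟩
  obtain rfl | hxy := eq_or_ne x y
  · rfl
  · exact SimpleGraph.ConnectedComponent.sound (hs hx hy hxy).reachable

theorem even_ncard_add_ncard_oddComponents {W : Type*} [Finite W] (H : SimpleGraph W)
    (hW : Even (Nat.card W)) (u : Set W) :
    Even (u.ncard + ((⊤ : H.Subgraph).deleteVerts u).coe.oddComponents.ncard) := by
  have hodd := SimpleGraph.odd_ncard_oddComponents ((⊤ : H.Subgraph).deleteVerts u).coe
  have hcard := Set.ncard_add_ncard_compl u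
  have verts_eq : ((⊤ : H.Subgraph).deleteVerts u).verts = uᶜ := by
    rw [SimpleGraph.Subgraph.deleteVerts_verts, SimpleGraph.Subgraph.verts_top,
      Set.compl_eq_univ_sdiff]
  rw [Nat.card_coe_set_eq, congrArg Set.ncard verts_eq] at hodd
  grind

variable {V : Type*} [DecidableEq V] {G : SimpleGraph V} [G.LocallyFinite]

theorem even_card_of_outArcs_eq_empty {d : ℕ} (hd : Odd d) (hreg : G.IsRegularOfDegree d)
    {A : Finset V} (hA : outArcs G A = ∅) : Even A.card := by
  classical
  have degree_eq (x : A) : (G.induce (A : Set V)).degree x = d := by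
    have mem_of_adj (y : V) (h : G.Adj x y) : y ∈ A := by
      by_contra hy
      exact Finset.notMem_empty (⟨x, y⟩ : Σ _ : V, V) (hA ▸ mem_outArcs.2 ⟨x.2, h, hy⟩)
    rw [← hreg x, ← SimpleGraph.card_neighborFinset_eq_degree,
      ← SimpleGraph.card_neighborFinset_eq_degree]
    exact Finset.card_bij (fun y _ => y) (fun y hy => by simpa using hy)
      (fun y _ z _ h => Subtype.ext h) fun y hy =>
        ⟨⟨y, mem_of_adj y ((G.mem_neighborFinset x y).1 hy)⟩, by simpa using hy, rfl⟩
  have heven := (G.induce (A : Set V)).even_card_odd_degree_vertices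
  simpa [degree_eq, hd] using heven

theorem le_card_outArcs_of_odd (ht : ∀ x y, ∃ σ : G ≃g G, σ x = y) {d : ℕ} (hd : Odd d)
    (hreg : G.IsRegularOfDegree d) {A : Finset V} (hA : Odd A.card) :
    d ≤ (outArcs G A).card := by
  refine le_card_outArcs ht hreg (Finset.nonempty_iff_ne_empty.2 fun hempty => ?_)
  exact Nat.not_even_iff_odd.2 hA (even_card_of_outArcs_eq_empty hd hreg hempty)

theorem card_le_card_of_outArcs_snd_mem {ι : Type*} {d : ℕ} (hd : 0 < d)
    (hdeg : ∀ x, G.degree x ≤ d) {I : Finset ι} {S : ι → Finset V} {U : Finset V}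
    (hS : (I : Set ι).PairwiseDisjoint S) (hcut : ∀ i ∈ I, d ≤ (outArcs G (S i)).card)
    (hU : ∀ i ∈ I, ∀ a ∈ outArcs G (S i), a.2 ∈ U) : I.card ≤ U.card := by
  have disjoint_outArcs : (I : Set ι).PairwiseDisjoint fun i => outArcs G (S i) :=
    fun i hi j hj hij => Finset.disjoint_left.2 fun a hai haj =>
      Finset.disjoint_left.1 (hS hi hj hij) (mem_outArcs.1 hai).1 (mem_outArcs.1 haj).1
  have card_outArcs_le :
      (I.biUnion fun i => outArcs G (S i)).card ≤ (U.sigma fun x => G.neighborFinset x).card := by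
    refine Finset.card_le_card_of_injOn (fun a => ⟨a.2, a.1⟩) (fun a ha => ?_) ?_
    · obtain ⟨i, hi, ha⟩ := Finset.mem_biUnion.1 ha
      exact Finset.mem_sigma.2
        ⟨hU i hi a ha, (G.mem_neighborFinset _ _).2 (mem_outArcs.1 ha).2.1.symm⟩
    · rintro ⟨x, y⟩ _ ⟨x', y'⟩ _ h
      cases h
      rfl
  refine Nat.le_of_mul_le_mul_right ?_ hd
  calc I.card * d ≤ ∑ i ∈ I, (outArcs G (S i)).card := Finset.card_nsmul_le_sum _ _ _ hcut
    _ = (I.biUnion fun i => outArcs G (S i)).card := (Finset.card_biUnion disjoint_outArcs).symm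
    _ ≤ ∑ x ∈ U, G.degree x := by
      simpa only [Finset.card_sigma, SimpleGraph.card_neighborFinset_eq_degree]
        using card_outArcs_le
    _ ≤ U.card * d := Finset.sum_le_card_nsmul _ _ _ fun x _ => hdeg x

/-- The subgraph of `G` induced on `N`, with all vertices outside `F` joined to each other. If `N`
contains the neighbours of `F`, its perfect matchings match the vertices in `F` along edges
of `G`. -/
def cliqueOutside (G : SimpleGraph V) (F N : Finset V) : SimpleGraph N :=
  SimpleGraph.fromRel fun x y => G.Adj x y ∨ (x : V) ∉ F ∧ (y : V) ∉ F

theorem ncard_components_inside_le {d : ℕ} (hd : 0 < d) (hdeg : ∀ x, G.degree x ≤ d)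
    (hcut : ∀ A : Finset V, Odd A.card → d ≤ (outArcs G A).card) {F N : Finset V}
    (hN : ∀ x ∈ F, G.neighborFinset x ⊆ N) (u : Set N) :
    {c ∈ ((⊤ : (cliqueOutside G F N).Subgraph).deleteVerts u).coe.oddComponents |
      ∀ x ∈ c.supp, (x.1 : V) ∈ F}.ncard ≤ u.ncard := by
  classical
  set K := ((⊤ : (cliqueOutside G F N).Subgraph).deleteVerts u).coe
  let toV : ((⊤ : (cliqueOutside G F N).Subgraph).deleteVerts u).verts ↪ V :=
    (Function.Embedding.subtype _).trans (Function.Embedding.subtype _)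
  rw [Set.ncard_eq_toFinset_card', Set.ncard_eq_toFinset_card',
    ← Finset.card_map (Function.Embedding.subtype _)]
  refine card_le_card_of_outArcs_snd_mem hd hdeg (S := fun c => c.supp.toFinset.map toV)
    (fun c _ c' _ hne => ?_) (fun c hc => hcut _ ?_) fun c hc => ?_
  · exact (Finset.disjoint_map toV).2 (Set.disjoint_toFinset.2
      (SimpleGraph.pairwise_disjoint_supp_connectedComponent K hne))
  · rw [Finset.card_map, ← Set.ncard_eq_toFinset_card']
    exact (Set.mem_toFinset.1 hc).1
  · rintro ⟨x, y⟩ hxy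
    obtain ⟨hx, hadj, hy⟩ : x ∈ _ ∧ G.Adj x y ∧ y ∉ _ := mem_outArcs.1 hxy
    obtain ⟨x, hxc, rfl⟩ := Finset.mem_map.1 hx
    rw [Set.mem_toFinset] at hxc
    have hyN : y ∈ N := hN _ ((Set.mem_toFinset.1 hc).2 x hxc) ((G.mem_neighborFinset _ _).2 hadj)
    refine Finset.mem_map.2 ⟨⟨y, hyN⟩, ?_, rfl⟩
    by_contra hyu
    rw [Set.mem_toFinset] at hyu
    have adj : K.Adj x ⟨⟨y, hyN⟩, trivial, hyu⟩ := SimpleGraph.Subgraph.deleteVerts_adj.2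
      ⟨trivial, x.2.2, trivial, hyu, fun h => hadj.ne (congrArg Subtype.val h), .inl (.inl hadj)⟩
    refine hy (Finset.mem_map.2 ⟨⟨⟨y, hyN⟩, trivial, hyu⟩, Set.mem_toFinset.2 ?_, rfl⟩)
    exact c.mem_supp_of_adj_mem_supp hxc adj

theorem not_isTutteViolator_cliqueOutside {d : ℕ} (hd : 0 < d) (hdeg : ∀ x, G.degree x ≤ d)
    (hcut : ∀ A : Finset V, Odd A.card → d ≤ (outArcs G A).card) {F N : Finset V}
    (hN : ∀ x ∈ F, G.neighborFinset x ⊆ N) (heven : Even N.card) (u : Set N) :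
    ¬ (cliqueOutside G F N).IsTutteViolator u := by
  have parity := even_ncard_add_ncard_oddComponents (cliqueOutside G F N) (by simpa using heven) u
  have inside := ncard_components_inside_le hd hdeg hcut hN u
  rw [SimpleGraph.IsTutteViolator]
  set K := ((⊤ : (cliqueOutside G F N).Subgraph).deleteVerts u).coe
  have isClique : K.IsClique {x | (x.1 : V) ∉ F} := by
    intro x hx y hy hxy
    have hxy' : (x : N) ≠ y := fun h => hxy (Subtype.ext h)
    exact SimpleGraph.Subgraph.deleteVerts_adj.2
      ⟨trivial, x.2.2, trivial, y.2.2, hxy', .inl (.inr ⟨hx, hy⟩)⟩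
  have outside := Set.ncard_le_one_iff_subsingleton.2
    (subsingleton_connectedComponents_inter isClique)
  have subset : K.oddComponents ⊆ {c ∈ K.oddComponents | ∀ x ∈ c.supp, (x.1 : V) ∈ F} ∪
      {c | (c.supp ∩ {x | (x.1 : V) ∉ F}).Nonempty} := by
    intro c hc
    by_cases h : ∀ x ∈ c.supp, (x.1 : V) ∈ F
    · exact .inl ⟨hc, h⟩
    · push Not at h
      exact .inr h
  have := (Set.ncard_le_ncard subset).trans (Set.ncard_union_le _ _)
  grind

theorem exists_partial_matching {d : ℕ} (hd : 0 < d) (hreg : G.IsRegularOfDegree d)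
    (hcut : ∀ A : Finset V, Odd A.card → d ≤ (outArcs G A).card) (F : Finset V) :
    ∃ f : V → V, ∀ x ∈ F, G.Adj x (f x) ∧ (f x ∈ F → f (f x) = x) := by
  have even_card (_ : Finite V) : Even (Nat.card V) := by
    have := Fintype.ofFinite V
    by_contra hodd
    have outArcs_univ : outArcs G Finset.univ = ∅ :=
      Finset.eq_empty_of_forall_notMem fun a ha => (mem_outArcs.1 ha).2.2 (Finset.mem_univ _)
    have := hcut Finset.univ (by simpa using hodd)
    rw [outArcs_univ, Finset.card_empty] at this
    omega
  obtain ⟨N, hFN, heven⟩ :=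
    exists_superset_even_card even_card (F ∪ F.biUnion fun x => G.neighborFinset x)
  obtain ⟨hFN, hN⟩ := Finset.union_subset_iff.1 hFN
  obtain ⟨M, hM⟩ := SimpleGraph.tutte.2 (not_isTutteViolator_cliqueOutside hd
    (fun x => (hreg x).le) hcut (Finset.biUnion_subset.1 hN) heven)
  choose f hf f_unique using SimpleGraph.Subgraph.isPerfectMatching_iff.1 hM
  refine ⟨fun x => if hx : x ∈ F then f ⟨x, hFN hx⟩ else x, fun x hx => ?_⟩
  have adj := (hf ⟨x, hFN hx⟩).adj_sub
  beta_reduce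
  rw [dif_pos hx]
  refine ⟨?_, fun hfx => ?_⟩
  · obtain ⟨-, (h | ⟨hxF, -⟩) | h | ⟨-, hxF⟩⟩ := adj
    exacts [h, absurd hx hxF, h.symm, absurd hx hxF]
  · rw [dif_pos hfx]
    exact congrArg _ (f_unique _ _ (hf _).symm).symm

/-- A perfect matching, given as the involution that exchanges the ends of its edges. -/
theorem exists_involutive_adj_of_le_card_outArcs {d : ℕ} (hd : 0 < d)
    (hreg : G.IsRegularOfDegree d) (hcut : ∀ A : Finset V, Odd A.card → d ≤ (outArcs G A).card) :
    ∃ f : V → V, Function.Involutive f ∧ ∀ x, G.Adj x (f x) := by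
  choose f hf using exists_partial_matching hd hreg hcut
  have nbr (x : V) : ∃ y, G.Adj x y := (G.degree_pos_iff_exists_adj x).1 (hreg x ▸ hd)
  choose nbr adj_nbr using nbr
  obtain ⟨χ, hχ⟩ := Finset.rado_selection (β := fun x => G.neighborSet x) fun F x =>
    if hx : x ∈ F then ⟨f F x, (hf F x hx).1⟩ else ⟨nbr x, adj_nbr x⟩
  refine ⟨fun x => χ x, fun x => ?_, fun x => (χ x).2⟩
  obtain ⟨F, hF, hχF⟩ := hχ {x, ↑(χ x)}
  have hx : x ∈ F := hF (by simp)
  have hχx : ↑(χ x) ∈ F := hF (by simp)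
  have χ_eq : (χ x : V) = f F x := by rw [hχF x (by simp), dif_pos hx]
  have χ_χ_eq : (χ (χ x) : V) = f F (χ x) := by rw [hχF (χ x) (by simp), dif_pos hχx]
  change (χ (χ x) : V) = x
  rw [χ_χ_eq, χ_eq, (hf F x hx).2 (χ_eq ▸ hχx)]

end PerfectMatching

theorem exists_involutive_adj_of_odd {V : Type*} {G : SimpleGraph V} [G.LocallyFinite]
    (ht : ∀ x y, ∃ σ : G ≃g G, σ x = y) {d : ℕ} (hd : Odd d)
    (hreg : G.IsRegularOfDegree d) :
    ∃ f : V → V, Function.Involutive f ∧ ∀ x, G.Adj x (f x) := by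
  classical
  exact exists_involutive_adj_of_le_card_outArcs hd.pos hreg fun _ =>
    le_card_outArcs_of_odd ht hd hreg

theorem exists_bijOn_univ_of_equiv {α β : Type*} {s : Set α} (φ : s ≃ β) (b : β) :
    ∃ f : α → β, Set.BijOn f s Set.univ := by
  have hcomp : Set.BijOn (Function.extend Subtype.val φ (fun _ => b) ∘ (Subtype.val : s → α))
      Set.univ Set.univ := by
    rw [Function.extend_comp Subtype.val_injective]
    exact φ.bijective.bijOn_univ
  rw [Set.bijOn_comp_iff Subtype.val_injective.injOn, Set.image_univ, Subtype.range_coe] at hcomp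
  exact ⟨_, hcomp⟩

namespace MGraph

variable {G : MGraph.{u}}

theorem init_inv (e : G.E) : G.init (G.inv e) = G.term e :=
  congrArg G.term (G.inv_inv e)

theorem term_inv (e : G.E) : G.term (G.inv e) = G.init e :=
  rfl

theorem Hom.map_init {G H : MGraph.{u}} (f : Hom G H) (e : G.E) :
    f.onV (G.init e) = H.init (f.onE e) := by
  rw [init, f.map_term, f.map_inv, init]

/-- The edge colourings that come from partite presentations: each vertex is the initial vertex of
exactly one edge of each colour, and inverting an edge changes its colour by `ι`. -/
structure IsColouring (G : MGraph.{u}) {K : Type*} (ι : K → K) (col : G.E → K) : Prop where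
  col_inv : ∀ e, col (G.inv e) = ι (col e)
  bijective : Function.Bijective fun e => (G.init e, col e)

/-- The existence of a colouring in the sense of `IsColouring`. -/
def Colourable (G : MGraph.{u}) : Prop :=
  ∃ (K : Type u) (ι : K → K) (col : G.E → K), G.IsColouring ι col

theorem colourable_of_isEmpty [IsEmpty G.E] : G.Colourable :=
  ⟨PEmpty, id, isEmptyElim, isEmptyElim, isEmptyElim, fun k => isEmptyElim k.2⟩

theorem IsColouring.colourable {K : Type*} {ι : K → K} {col : G.E → K}
    (h : G.IsColouring ι col) : G.Colourable := by
  obtain hE | ⟨⟨e⟩⟩ := isEmpty_or_nonempty G.E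
  · exact colourable_of_isEmpty
  choose edge hedge using fun k => h.bijective.2 (G.init e, k)
  have col_edge (k : K) : col (edge k) = k := congrArg Prod.snd (hedge k)
  have : Small.{u} K := small_of_injective (Function.LeftInverse.injective col_edge)
  refine ⟨Shrink.{u} K, fun k => equivShrink K (ι ((equivShrink K).symm k)),
    fun e => equivShrink K (col e), fun e => ?_, ?_⟩
  · rw [Equiv.symm_apply_apply, h.col_inv]
  · exact (Function.bijective_id.prodMap (equivShrink K).bijective).comp h.bijective

/-- The subgraph with all vertices and with the edges in a set `S` that is closed under
inversion. -/
def edgeSub (G : MGraph.{u}) (S : Set G.E) (hS : ∀ e ∈ S, G.inv e ∈ S) : MGraph.{u} where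
  V := G.V
  E := S
  inv e := ⟨G.inv e, hS e e.2⟩
  inv_inv e := Subtype.ext (G.inv_inv e)
  inv_ne e h := G.inv_ne e (congrArg Subtype.val h)
  term e := G.term e

theorem colourable_of_partition {I : Type*} (p : G.E → I) (hp : ∀ e, p (G.inv e) = p e)
    (h : ∀ i, (G.edgeSub (p ⁻¹' {i}) fun e he => (hp e).trans he).Colourable) :
    G.Colourable := by
  choose K ι col hcol using h
  have sigma_eq {i : I} (e : G.E) (he : p e = i) :
      (⟨p e, col (p e) ⟨e, rfl⟩⟩ : Σ i, K i) = ⟨i, col i ⟨e, he⟩⟩ := by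
    subst he
    rfl
  refine IsColouring.colourable (ι := Sigma.map id ι) (col := fun e => ⟨p e, col (p e) ⟨e, rfl⟩⟩)
    ⟨fun e => ?_, fun e e' h => ?_, fun ⟨x, i, k⟩ => ?_⟩
  · exact (sigma_eq _ (hp e)).trans (congrArg (Sigma.mk (p e)) ((hcol (p e)).col_inv ⟨e, rfl⟩))
  · obtain ⟨hinit, hsigma⟩ := Prod.mk.inj h
    have hpe : p e = p e' := congrArg Sigma.fst hsigma
    rw [sigma_eq e hpe] at hsigma
    have hcol_eq := eq_of_heq (Sigma.mk.inj hsigma).2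
    exact congrArg Subtype.val ((hcol (p e')).bijective.1
      (a₁ := ⟨e, hpe⟩) (a₂ := ⟨e', rfl⟩) (Prod.ext hinit hcol_eq))
  · obtain ⟨⟨e, he⟩, hek⟩ := (hcol i).bijective.2 (x, k)
    obtain ⟨hinit, rfl⟩ := Prod.mk.inj hek
    exact ⟨e, Prod.ext hinit (sigma_eq e he)⟩

theorem Colourable.of_hom {H : MGraph.{u}} (hH : H.Colourable) (f : Hom G H)
    (hf : Function.Bijective f.onV) {L : Type*} (label : G.E → L)
    (label_inv : ∀ e, label (G.inv e) = label e)
    (hlabel : Function.Bijective fun e => (f.onE e, label e)) : G.Colourable := by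
  obtain ⟨K, ι, col, hcol⟩ := hH
  refine IsColouring.colourable (ι := Prod.map ι id) (col := fun e => (col (f.onE e), label e))
    ⟨fun e => ?_, ?_⟩
  · rw [f.map_inv, hcol.col_inv, label_inv]
    rfl
  · have hcomp := (Equiv.prodAssoc H.V K L).bijective.comp
      ((hcol.bijective.prodMap Function.bijective_id).comp hlabel)
    refine (Function.Bijective.of_comp_iff' (hf.prodMap Function.bijective_id) _).1 ?_
    convert hcomp using 1
    exact funext fun e => Prod.ext (f.map_init e) rfl

theorem VertexTransitive.colourable_of_loops (hG : G.VertexTransitive)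
    (hloop : ∀ e, G.init e = G.term e) : G.Colourable := by
  obtain hE | ⟨⟨e⟩⟩ := isEmpty_or_nonempty G.E
  · exact colourable_of_isEmpty
  let K := {a // G.init a = G.init e}
  choose f hf using fun x => hG x (G.init e)
  have init_f (e) : G.init ((f (G.init e)).onE e) = _ := ((f _).map_init e).symm.trans (hf _)
  refine IsColouring.colourable (K := K) (ι := fun a => ⟨G.inv a, by rw [init_inv, ← hloop, a.2]⟩)
    (col := fun a => ⟨(f (G.init a)).onE a, init_f a⟩)
    ⟨fun a => Subtype.ext ?_, fun a b h => ?_, fun ⟨x, k, hk⟩ => ?_⟩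
  · simp only [init_inv, ← hloop, (f _).map_inv]
  · obtain ⟨hinit, hcol⟩ := Prod.mk.inj h
    have hcol : (f (G.init a)).onE a = (f (G.init b)).onE b := congrArg Subtype.val hcol
    rw [← hinit] at hcol
    exact (f _).bijective_onE.1 hcol
  · obtain ⟨a, rfl⟩ := (f x).bijective_onE.2 k
    obtain rfl : G.init a = x :=
      (f x).bijective_onV.1 (((f x).map_init a).trans (hk.trans (hf x).symm))
    exact ⟨a, rfl⟩

/-- The graph whose directed edges are the darts of a simple graph. -/
def ofSimpleGraph {V : Type u} (H : SimpleGraph V) : MGraph.{u} where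
  V := V
  E := H.Dart
  inv := SimpleGraph.Dart.symm
  inv_inv := SimpleGraph.Dart.symm_symm
  inv_ne := SimpleGraph.Dart.symm_ne
  term d := d.snd

/-- The simple graph obtained by forgetting loops and multiplicities. -/
def toSimpleGraph (G : MGraph.{u}) : SimpleGraph G.V where
  Adj x y := x ≠ y ∧ ∃ e, G.init e = x ∧ G.term e = y
  symm := ⟨fun _ _ ⟨hne, e, hx, hy⟩ => ⟨hne.symm, G.inv e, (init_inv e).trans hy, hx⟩⟩
  loopless := ⟨fun _ h => h.1 rfl⟩

/-- The projection of a loopless graph onto its underlying simple graph. -/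
def homOfSimpleGraph (hloop : ∀ e, G.init e ≠ G.term e) :
    Hom G (ofSimpleGraph G.toSimpleGraph) where
  onV := id
  onE e := ⟨(G.init e, G.term e), hloop e, e, rfl, rfl⟩
  map_inv e := SimpleGraph.Dart.ext _ _ (Prod.ext (init_inv e) rfl)
  map_term _ := rfl

/-- The directed edges from `x` to `y`. -/
def between (G : MGraph.{u}) (x y : G.V) : Set G.E :=
  {e | G.init e = x ∧ G.term e = y}

theorem bijOn_inv_between (x y : G.V) : Set.BijOn G.inv (G.between x y) (G.between y x) := by
  refine Set.InvOn.bijOn (f' := G.inv) ⟨fun e _ => G.inv_inv e, fun e _ => G.inv_inv e⟩ ?_ ?_ <;>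
    exact fun e he => ⟨(init_inv e).trans he.2, he.1⟩

theorem Iso.bijOn_between (f : Iso G G) (x y : G.V) :
    Set.BijOn f.onE (G.between x y) (G.between (f.onV x) (f.onV y)) := by
  have mem_iff (e) : f.onE e ∈ G.between (f.onV x) (f.onV y) ↔ e ∈ G.between x y := by
    simp only [between, Set.mem_ofPred_eq, ← f.map_init, ← f.map_term, f.bijective_onV.1.eq_iff]
  refine ⟨fun e => (mem_iff e).2, f.bijective_onE.1.injOn, fun e he => ?_⟩
  obtain ⟨e, rfl⟩ := f.bijective_onE.2 e
  exact ⟨e, (mem_iff e).1 he, rfl⟩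

theorem exists_labelling (hloop : ∀ e, G.init e ≠ G.term e) {L : Type*}
    (hL : ∀ e, Nonempty (G.between (G.init e) (G.term e) ≃ L)) :
    ∃ label : G.E → L, (∀ e, label (G.inv e) = label e) ∧
      Function.Bijective fun e => ((homOfSimpleGraph hloop).onE e, label e) := by
  classical
  let : LinearOrder G.V := IsWellOrder.linearOrder WellOrderingRel
  have bijOn_between (x y : G.V) (h : G.toSimpleGraph.Adj x y) :
      ∃ φ : G.E → L, Set.BijOn φ (G.between x y) Set.univ := by
    obtain ⟨-, e, rfl, rfl⟩ := h
    obtain ⟨φ⟩ := hL e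
    exact exists_bijOn_univ_of_equiv φ (φ ⟨e, rfl, rfl⟩)
  choose φ hφ using bijOn_between
  have adj (e : G.E) : G.toSimpleGraph.Adj (G.init e) (G.term e) := ⟨hloop e, e, rfl, rfl⟩
  let label (e : G.E) : L :=
    if G.init e < G.term e then φ _ _ (adj e) e else φ _ _ (adj e).symm (G.inv e)
  have bijOn_label (x y : G.V) (h : G.toSimpleGraph.Adj x y) :
      Set.BijOn label (G.between x y) Set.univ := by
    obtain hlt | hlt := h.1.lt_or_gt
    · refine (hφ x y h).congr fun e ⟨hx, hy⟩ => ?_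
      simp only [label, hx, hy, if_pos hlt]
    · refine ((hφ y x h.symm).comp (bijOn_inv_between x y)).congr fun e ⟨hx, hy⟩ => ?_
      simp only [label, hx, hy, if_neg hlt.not_gt, Function.comp_apply]
  refine ⟨label, fun e => ?_, fun e e' h => ?_, fun ⟨d, l⟩ => ?_⟩
  · obtain hlt | hlt := (hloop e).lt_or_gt <;>
      simp only [label, init_inv, term_inv, G.inv_inv, if_pos hlt, if_neg hlt.not_gt]
  · obtain ⟨hd, hl⟩ := Prod.mk.inj h
    have hinit : G.init e = G.init e' := congrArg (fun d => d.fst) hd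
    have hterm : G.term e = G.term e' := congrArg (fun d => d.snd) hd
    exact (bijOn_label _ _ (adj e')).injOn ⟨hinit, hterm⟩ ⟨rfl, rfl⟩ hl
  · obtain ⟨e, ⟨hx, hy⟩, rfl⟩ := (bijOn_label d.fst d.snd d.adj).surjOn (Set.mem_univ l)
    exact ⟨e, Prod.ext (SimpleGraph.Dart.ext _ _ (Prod.ext hx hy)) rfl⟩

end MGraph

section InfiniteDegree

variable {V : Type*} {H : SimpleGraph V}

/-- The finite partial proper edge colourings of `H` with colours in `ℕ`, as sets of pairs of an
edge and its colour. -/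
structure IsPartialColouring (H : SimpleGraph V) (S : Finset (Sym2 V × ℕ)) : Prop where
  mem_edgeSet : ∀ a ∈ S, a.1 ∈ H.edgeSet
  functional : ∀ a ∈ S, ∀ b ∈ S, a.1 = b.1 → a = b
  proper : ∀ a ∈ S, ∀ b ∈ S, a.2 = b.2 → ∀ x ∈ a.1, x ∈ b.1 → a = b

open Classical in
theorem IsPartialColouring.insert {S : Finset (Sym2 V × ℕ)} (hS : IsPartialColouring H S)
    {e : Sym2 V} {n : ℕ} (he : e ∈ H.edgeSet) (hedge : ∀ a ∈ S, a.1 ≠ e)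
    (hcol : ∀ a ∈ S, a.2 = n → ∀ x ∈ a.1, x ∉ e) : IsPartialColouring H (insert (e, n) S) := by
  constructor <;> simp only [Finset.forall_mem_insert]
  · exact ⟨he, hS.mem_edgeSet⟩
  · exact ⟨⟨fun _ => trivial, fun b hb h => absurd h.symm (hedge b hb)⟩,
      fun a ha => ⟨fun h => absurd h (hedge a ha), hS.functional a ha⟩⟩
  · exact ⟨⟨fun _ _ _ _ => trivial, fun b hb h x hx hxb => absurd hx (hcol b hb h.symm x hxb)⟩,
      fun a ha => ⟨fun h x hxa hx => absurd hx (hcol a ha h x hxa), hS.proper a ha⟩⟩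

open Classical in
theorem IsPartialColouring.exists_edge_mem {S : Finset (Sym2 V × ℕ)} (hS : IsPartialColouring H S)
    {e : Sym2 V} (he : e ∈ H.edgeSet) :
    ∃ T, S ⊆ T ∧ IsPartialColouring H T ∧ ∃ n, (e, n) ∈ T := by
  by_cases h : ∃ n, (e, n) ∈ S
  · exact ⟨S, Finset.Subset.rfl, hS, h⟩
  obtain ⟨n, hn⟩ := Infinite.exists_notMem_finset (S.image Prod.snd)
  refine ⟨_, Finset.subset_insert _ _, hS.insert (n := n) he ?_ ?_, n, Finset.mem_insert_self _ _⟩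
  · rintro a ha rfl
    exact h ⟨a.2, ha⟩
  · rintro a ha rfl
    exact absurd (Finset.mem_image_of_mem _ ha) hn

open Classical in
theorem IsPartialColouring.exists_colour_mem {S : Finset (Sym2 V × ℕ)}
    (hS : IsPartialColouring H S) {x : V} (hx : (H.neighborSet x).Infinite) (n : ℕ) :
    ∃ T, S ⊆ T ∧ IsPartialColouring H T ∧ ∃ e, x ∈ e ∧ (e, n) ∈ T := by
  by_cases h : ∃ e, x ∈ e ∧ (e, n) ∈ S
  · exact ⟨S, Finset.Subset.rfl, hS, h⟩
  obtain ⟨y, hxy, hy⟩ := hx.exists_notMem_finset (S.biUnion fun a => a.1.toFinset)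
  have hy (a) (ha : a ∈ S) : y ∉ a.1 := fun h =>
    hy (Finset.mem_biUnion.2 ⟨a, ha, Sym2.mem_toFinset.2 h⟩)
  refine ⟨_, Finset.subset_insert _ _, hS.insert (e := s(x, y)) (n := n) hxy ?_ ?_, s(x, y),
    Sym2.mem_mk_left x y, Finset.mem_insert_self _ _⟩
  · exact fun a ha hae => hy a ha (hae ▸ Sym2.mem_mk_right x y)
  · rintro a ha rfl z hz hze
    obtain rfl | rfl := Sym2.mem_iff.1 hze
    · exact h ⟨a.1, hz, ha⟩
    · exact hy a ha hz

theorem exists_partition_into_perfectMatchings [Countable V]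
    (hinf : ∀ x, (H.neighborSet x).Infinite) :
    ∃ col : H.edgeSet → ℕ, ∀ x n, ∃! e : H.edgeSet, x ∈ e.1 ∧ col e = n := by
  let P := {S : Finset (Sym2 V × ℕ) // IsPartialColouring H S}
  have : Countable H.edgeSet := Subtype.countable
  have : Encodable (H.edgeSet ⊕ V × ℕ) := Encodable.ofCountable _
  let goal : H.edgeSet ⊕ V × ℕ → Order.Cofinal P :=
    Sum.elim
      (fun e =>
        { carrier := {S | ∃ n, (e.1, n) ∈ S.1}
          isCofinal := fun S =>
            let ⟨T, hST, hT, h⟩ := S.2.exists_edge_mem e.2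
            ⟨⟨T, hT⟩, h, hST⟩ })
      (fun p =>
        { carrier := {S | ∃ e, p.1 ∈ e ∧ (e, p.2) ∈ S.1}
          isCofinal := fun S =>
            let ⟨T, hST, hT, h⟩ := S.2.exists_colour_mem (hinf p.1) p.2
            ⟨⟨T, hT⟩, h, hST⟩ })
  let J := Order.idealOfCofinals (⟨∅, by constructor <;> simp⟩ : P) goal
  have exists_common {S T : P} (hS : S ∈ J) (hT : T ∈ J) {a b} (ha : a ∈ S.1) (hb : b ∈ T.1) :
      ∃ R : P, R ∈ J ∧ a ∈ R.1 ∧ b ∈ R.1 := by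
    obtain ⟨R, hR, hSR, hTR⟩ := J.directed S hS T hT
    exact ⟨R, hR, hSR ha, hTR hb⟩
  have exists_colour (e : H.edgeSet) : ∃ n, ∃ S ∈ J, (e.1, n) ∈ S.1 := by
    obtain ⟨S, ⟨n, hn⟩, hS⟩ := Order.cofinal_meets_idealOfCofinals _ goal (Sum.inl e)
    exact ⟨n, S, hS, hn⟩
  choose col S hS hcol using exists_colour
  refine ⟨col, fun x n => ?_⟩
  obtain ⟨T, ⟨e, hx, hn⟩, hT⟩ := Order.cofinal_meets_idealOfCofinals _ goal (Sum.inr (x, n))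
  have he : e ∈ H.edgeSet := T.2.mem_edgeSet _ hn
  refine ⟨⟨e, he⟩, ⟨hx, ?_⟩, ?_⟩
  · obtain ⟨R, -, hR, hR'⟩ := exists_common (hS ⟨e, he⟩) hT (hcol _) hn
    exact congrArg Prod.snd (R.2.functional _ hR _ hR' rfl)
  · rintro e' ⟨hx', rfl⟩
    obtain ⟨R, -, hR, hR'⟩ := exists_common (hS e') hT (hcol _) hn
    exact Subtype.ext (congrArg Prod.fst (R.2.proper _ hR _ hR' rfl x hx' hx))

end InfiniteDegree

namespace MGraph

theorem colourable_ofSimpleGraph_of_infinite {V : Type u} [Countable V] {H : SimpleGraph V}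
    (hinf : ∀ x, (H.neighborSet x).Infinite) : (ofSimpleGraph H).Colourable := by
  obtain ⟨col, hcol⟩ := exists_partition_into_perfectMatchings hinf
  refine IsColouring.colourable (ι := id) (col := fun d : H.Dart => col ⟨d.edge, d.edge_mem⟩)
    ⟨fun d => congrArg col (Subtype.ext d.edge_symm), fun d d' h => ?_, fun ⟨x, n⟩ => ?_⟩
  · obtain ⟨hfst, hcol_eq⟩ := Prod.mk.inj h
    have hfst : d.fst = d'.fst := hfst
    have hedge := (hcol d.fst (col ⟨d.edge, d.edge_mem⟩)).unique ⟨Sym2.mem_mk_left _ _, rfl⟩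
      (y₂ := ⟨d'.edge, d'.edge_mem⟩) ⟨hfst ▸ Sym2.mem_mk_left _ _, hcol_eq.symm⟩
    obtain h | rfl := SimpleGraph.dart_edge_eq_iff d d' |>.1 (congrArg Subtype.val hedge)
    · exact h
    · exact absurd hfst d'.snd_ne_fst
  · obtain ⟨⟨e, he⟩, ⟨⟨y, rfl⟩, rfl⟩, -⟩ := hcol x n
    exact ⟨⟨(x, y), he⟩, rfl⟩

end MGraph

namespace MGraph

variable {G : MGraph.{u}}

theorem sym2_inv_eq_iff {e e' : G.E} :
    s(e, G.inv e) = s(e', G.inv e') ↔ e = e' ∨ e = G.inv e' := by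
  rw [Sym2.eq_iff]
  constructor
  · exact Or.imp And.left And.left
  · rintro (rfl | rfl)
    · exact Or.inl ⟨rfl, rfl⟩
    · exact Or.inr ⟨rfl, G.inv_inv e'⟩

-- Matching each edge pair `{e, e⁻¹}` with one of `k` copies of one of its ends orients that pair.
theorem exists_balanced_orientation {k : ℕ} (hk : k ≠ 0)
    (h : ∀ x, (G.init ⁻¹' {x}).encard = (2 * k : ℕ)) :
    ∃ O : Set G.E, (∀ e, G.inv e ∈ O ↔ e ∉ O) ∧ ∀ x, (O ∩ G.init ⁻¹' {x}).encard = k := by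
  let pair (d : G.E × Fin k) : Set.range fun e => s(e, G.inv e) := ⟨s(d.1, G.inv d.1), d.1, rfl⟩
  let copy (d : G.E × Fin k) : G.V × Fin k := (G.init d.1, d.2)
  have pair_eq_iff (d d' : G.E × Fin k) : pair d = pair d' ↔ d.1 = d'.1 ∨ d.1 = G.inv d'.1 :=
    Subtype.ext_iff.trans sym2_inv_eq_iff
  have encard_pair (a) : (pair ⁻¹' {a}).encard = (2 * k : ℕ) := by
    obtain ⟨-, e, rfl⟩ := a
    have : pair ⁻¹' {⟨_, e, rfl⟩} = {e, G.inv e} ×ˢ (Set.univ : Set (Fin k)) := by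
      ext d
      simpa using pair_eq_iff d (e, ⟨0, Nat.pos_of_ne_zero hk⟩)
    rw [this, Set.encard_prod, Set.encard_pair (G.inv_ne e).symm, Set.encard_univ]
    simp
  have encard_copy (b) : (copy ⁻¹' {b}).encard = (2 * k : ℕ) := by
    have : copy ⁻¹' {b} = (G.init ⁻¹' {b.1}) ×ˢ {b.2} := by
      ext d
      simp [copy, Prod.ext_iff]
    rw [this, Set.encard_prod, h, Set.encard_singleton, mul_one]
  obtain ⟨M, hpair, hcopy⟩ :=
    exists_bijOn_of_regular pair copy (mul_ne_zero two_ne_zero hk) encard_pair encard_copy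
  refine ⟨Prod.fst '' M, fun e => ⟨?_, fun he => ?_⟩, fun x => ?_⟩
  · rintro ⟨d, hd, hde⟩ ⟨d', hd', rfl⟩
    obtain rfl := hpair.injOn hd hd' ((pair_eq_iff d d').2 (Or.inr hde))
    exact G.inv_ne _ hde.symm
  · obtain ⟨d, hd, hde⟩ := hpair.surjOn (Set.mem_univ ⟨_, e, rfl⟩)
    obtain h | h := sym2_inv_eq_iff.1 (congrArg Subtype.val hde)
    · exact absurd ⟨d, hd, h⟩ he
    · exact ⟨d, hd, h⟩
  · have fst_injOn : Set.InjOn Prod.fst M :=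
      fun d hd d' hd' h => hpair.injOn hd hd' ((pair_eq_iff d d').2 (Or.inl h))
    have fibre_eq : M ∩ Prod.fst ⁻¹' (G.init ⁻¹' {x}) = M ∩ copy ⁻¹' ({x} ×ˢ Set.univ) := by
      ext d
      simp [copy]
    rw [← Set.image_inter_preimage, (fst_injOn.mono Set.inter_subset_left).encard_image, fibre_eq,
      ← (hcopy.injOn.mono Set.inter_subset_left).encard_image, Set.image_inter_preimage,
      hcopy.image_eq, Set.univ_inter, Set.encard_prod, Set.encard_singleton, Set.encard_univ]
    simp

theorem colourable_of_orientation {O : Set G.E} (hO : ∀ e, G.inv e ∈ O ↔ e ∉ O) {K : Type*}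
    {col : O → K} (hinit : Function.Bijective fun e : O => (G.init e, col e))
    (hterm : Function.Bijective fun e : O => (G.term e, col e)) : G.Colourable := by
  classical
  let dir (e : G.E) : K × Bool :=
    if h : e ∈ O then (col ⟨e, h⟩, true) else (col ⟨G.inv e, (hO e).2 h⟩, false)
  have dir_of_mem (e : O) : dir e = (col e, true) := dif_pos e.2
  have dir_inv_of_mem (e : O) : dir (G.inv e) = (col e, false) := by
    have : G.inv e ∉ O := fun h => (hO e).1 h e.2
    simp only [dir, dif_neg this, G.inv_inv]
  have mem_or (e : G.E) : (∃ a : O, e = a) ∨ ∃ a : O, e = G.inv a := by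
    by_cases h : e ∈ O
    · exact Or.inl ⟨⟨e, h⟩, rfl⟩
    · exact Or.inr ⟨⟨_, (hO e).2 h⟩, (G.inv_inv e).symm⟩
  refine IsColouring.colourable (ι := Prod.map id not) (col := dir)
    ⟨fun e => ?_, fun e e' h => ?_, fun ⟨x, i, b⟩ => ?_⟩
  · obtain ⟨a, rfl⟩ | ⟨a, rfl⟩ := mem_or e
    · rw [dir_of_mem, dir_inv_of_mem]
      rfl
    · rw [G.inv_inv, dir_of_mem, dir_inv_of_mem]
      rfl
  · obtain ⟨a, rfl⟩ | ⟨a, rfl⟩ := mem_or e <;> obtain ⟨a', rfl⟩ | ⟨a', rfl⟩ := mem_or e' <;>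
      simp only [dir_of_mem, dir_inv_of_mem, init_inv, Prod.mk.injEq, and_true, and_false,
        Bool.true_eq_false, Bool.false_eq_true] at h
    · exact congrArg Subtype.val (hinit.1 (Prod.ext h.1 h.2))
    · exact congrArg (G.inv ∘ Subtype.val) (hterm.1 (Prod.ext h.1 h.2))
  · cases b with
    | true =>
      obtain ⟨a, ha⟩ := hinit.2 (x, i)
      obtain ⟨rfl, rfl⟩ := Prod.mk.inj ha
      exact ⟨a, Prod.ext rfl (dir_of_mem a)⟩
    | false =>
      obtain ⟨a, ha⟩ := hterm.2 (x, i)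
      obtain ⟨rfl, rfl⟩ := Prod.mk.inj ha
      exact ⟨G.inv a, Prod.ext (init_inv _) (dir_inv_of_mem a)⟩

/-- Petersen's theorem on the 2-factors of regular graphs of even degree. -/
theorem colourable_of_even {k : ℕ} (h : ∀ x, (G.init ⁻¹' {x}).encard = (2 * k : ℕ)) :
    G.Colourable := by
  obtain rfl | hk := eq_or_ne k 0
  · have : IsEmpty G.E :=
      ⟨fun e => Set.notMem_empty e (Set.encard_eq_zero.1 (h (G.init e)) ▸ rfl)⟩
    exact colourable_of_isEmpty
  obtain ⟨O, hO, hout⟩ := exists_balanced_orientation hk h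
  have hin (x : G.V) : (O ∩ G.term ⁻¹' {x}).encard = k := by
    have image_eq : G.inv '' (G.init ⁻¹' {x} \ (O ∩ G.init ⁻¹' {x})) = O ∩ G.term ⁻¹' {x} := by
      ext e
      rw [Set.mem_image_iff_of_inverse G.inv_inv G.inv_inv]
      simp [init_inv, hO, and_comm]
    rw [← image_eq, (Function.Involutive.injective G.inv_inv).encard_image,
      Set.encard_sdiff Set.inter_subset_right (Set.finite_of_encard_eq_coe (hout x)), h, hout]
    norm_cast
    omega
  obtain ⟨col, hinit, hterm⟩ := exists_colouring_of_regular k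
    (fun e : O => G.init e) (fun e : O => G.term e)
    (fun x => by
      rw [← hout x, ← Subtype.image_preimage_coe, Subtype.val_injective.encard_image]
      rfl)
    (fun x => by
      rw [← hin x, ← Subtype.image_preimage_coe, Subtype.val_injective.encard_image]
      rfl)
  exact colourable_of_orientation hO hinit hterm

end MGraph

namespace MGraph

theorem bijOn_snd_fst_preimage {V : Type*} {H : SimpleGraph V} (x : V) :
    Set.BijOn (fun d : H.Dart => d.snd) {d | d.fst = x} (H.neighborSet x) := by
  refine ⟨?_, ?_, fun y hxy => ⟨⟨(x, y), hxy⟩, rfl, rfl⟩⟩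
  · rintro d rfl
    exact d.adj
  · rintro d rfl d' hd' hsnd
    exact SimpleGraph.Dart.ext _ _ (Prod.ext (Eq.symm hd') hsnd)

theorem colourable_of_bijOn_init {G : MGraph.{u}} {M : Set G.E} (hM : ∀ e, G.inv e ∈ M ↔ e ∈ M)
    (hinit : Set.BijOn G.init M Set.univ) {k : ℕ}
    (h : ∀ x, (G.init ⁻¹' {x}).encard = (2 * k + 1 : ℕ)) : G.Colourable := by
  refine colourable_of_partition (fun e => e ∈ M) (fun e => propext (hM e)) fun i => ?_
  obtain rfl | rfl := Classical.propComplete i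
  · simp only [show (fun e => e ∈ M) ⁻¹' {True} = M by ext; simp]
    refine IsColouring.colourable (ι := id) (col := fun _ => ())
      ⟨fun _ => rfl, fun e e' h => Subtype.ext ?_, fun ⟨x, _⟩ => ?_⟩
    · exact hinit.injOn e.2 e'.2 (Prod.mk.inj h).1
    · obtain ⟨e, he, rfl⟩ := hinit.surjOn (Set.mem_univ x)
      exact ⟨⟨e, he⟩, rfl⟩
  · simp only [show (fun e => e ∈ M) ⁻¹' {False} = Mᶜ by ext; simp]
    exact colourable_of_even fun x => encard_preimage_domRestrict_compl hinit (h x)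

section SimpleGraph

variable {V : Type u} {H : SimpleGraph V}

theorem encard_init_preimage_ofSimpleGraph [H.LocallyFinite] {d : ℕ}
    (hreg : H.IsRegularOfDegree d) (x : V) :
    ((ofSimpleGraph H).init ⁻¹' {x}).encard = d := by
  rw [← hreg x, SimpleGraph.degree, ← Set.encard_coe_eq_coe_finsetCard,
    SimpleGraph.coe_neighborFinset, ← (bijOn_snd_fst_preimage x).image_eq,
    (bijOn_snd_fst_preimage x).injOn.encard_image]
  rfl

theorem colourable_ofSimpleGraph_of_odd [H.LocallyFinite]
    (ht : ∀ x y, ∃ σ : H ≃g H, σ x = y) {k : ℕ} (hreg : H.IsRegularOfDegree (2 * k + 1)) :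
    (ofSimpleGraph H).Colourable := by
  obtain ⟨f, hf, hadj⟩ := exists_involutive_adj_of_odd ht (odd_two_mul_add_one k) hreg
  have hdeg := encard_init_preimage_ofSimpleGraph hreg
  refine colourable_of_bijOn_init (M := {d : H.Dart | d.snd = f d.fst}) ?_ ?_ hdeg
  · exact fun d => hf.eq_iff.symm.trans eq_comm
  · refine ⟨fun _ _ => trivial, fun d hd d' hd' (hfst : d.fst = d'.fst) => ?_,
      fun x _ => ⟨⟨(x, f x), hadj x⟩, rfl, rfl⟩⟩
    exact SimpleGraph.Dart.ext _ _
      (Prod.ext hfst (hd.trans ((congrArg f hfst).trans (Eq.symm hd'))))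

theorem colourable_ofSimpleGraph [Countable V] (ht : ∀ x y, ∃ σ : H ≃g H, σ x = y) :
    (ofSimpleGraph H).Colourable := by
  by_cases hinf : ∃ x, (H.neighborSet x).Infinite
  · obtain ⟨x, hx⟩ := hinf
    refine colourable_ofSimpleGraph_of_infinite fun y => ?_
    obtain ⟨σ, rfl⟩ := ht x y
    rw [← Set.infinite_coe_iff] at hx ⊢
    exact (σ.mapNeighborSet x).infinite_iff.1 hx
  · push Not at hinf
    have : H.LocallyFinite := fun x => (hinf x).fintype
    obtain hV | ⟨⟨o⟩⟩ := isEmpty_or_nonempty V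
    · have : IsEmpty (ofSimpleGraph H).E := ⟨fun d : H.Dart => isEmptyElim d.fst⟩
      exact colourable_of_isEmpty
    have hreg : H.IsRegularOfDegree (H.degree o) := fun x => by
      obtain ⟨σ, rfl⟩ := ht o x
      exact σ.degree_eq o
    obtain ⟨k, hk | hk⟩ := Nat.even_or_odd' (H.degree o)
    · have hdeg := encard_init_preimage_ofSimpleGraph (hk ▸ hreg)
      exact colourable_of_even hdeg
    · exact colourable_ofSimpleGraph_of_odd ht (hk ▸ hreg)

end SimpleGraph

variable {G : MGraph.{u}}

theorem VertexTransitive.toSimpleGraph (hG : G.VertexTransitive) (x y : G.V) :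
    ∃ σ : G.toSimpleGraph ≃g G.toSimpleGraph, σ x = y := by
  obtain ⟨f, hf⟩ := hG x y
  refine ⟨⟨Equiv.ofBijective f.onV f.bijective_onV, fun {a b} => ?_⟩, hf⟩
  have adj_iff (a b) : G.toSimpleGraph.Adj a b ↔ a ≠ b ∧ (G.between a b).Nonempty := Iff.rfl
  rw [Equiv.ofBijective_apply, Equiv.ofBijective_apply, adj_iff, adj_iff,
    f.bijective_onV.1.ne_iff, ← (f.bijOn_between a b).image_eq, Set.image_nonempty]

theorem VertexTransitive.edgeSub (hG : G.VertexTransitive) {S : Set G.E}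
    (hS : ∀ e ∈ S, G.inv e ∈ S) (hiso : ∀ (f : Iso G G) e, f.onE e ∈ S ↔ e ∈ S) :
    (G.edgeSub S hS).VertexTransitive := by
  intro x y
  obtain ⟨f, hf⟩ := hG x y
  refine ⟨⟨⟨f.onV, Set.MapsTo.restrict f.onE S S fun e => (hiso f e).2,
    fun e => Subtype.ext (f.map_inv e.1), fun e => f.map_term e.1⟩, f.bijective_onV, ?_, ?_⟩, hf⟩
  · exact fun e e' h => Subtype.ext (f.bijective_onE.1 (congrArg Subtype.val h))
  · rintro ⟨e, he⟩
    obtain ⟨e, rfl⟩ := f.bijective_onE.2 e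
    exact ⟨⟨e, (hiso f e).1 he⟩, rfl⟩

/-- The data distinguishing edges by whether they are loops and by how many edges are parallel to
them. -/
def edgeType (G : MGraph.{u}) (e : G.E) : Prop × Cardinal.{u} :=
  (G.init e = G.term e, Cardinal.mk (G.between (G.init e) (G.term e)))

theorem edgeType_inv (e : G.E) : G.edgeType (G.inv e) = G.edgeType e := by
  simp only [edgeType, init_inv, term_inv, Prod.mk.injEq, eq_comm (a := G.term e), true_and]
  exact Cardinal.mk_congr ((bijOn_inv_between _ _).equiv _)

theorem Iso.edgeType_onE (f : Iso G G) (e : G.E) : G.edgeType (f.onE e) = G.edgeType e := by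
  simp only [edgeType, ← f.map_init, ← f.map_term, f.bijective_onV.1.eq_iff, Prod.mk.injEq,
    true_and]
  exact Cardinal.mk_congr ((f.bijOn_between _ _).equiv _).symm

theorem edgeType_eq_of_mem_between {e e' : G.E} (h : e' ∈ G.between (G.init e) (G.term e)) :
    G.edgeType e' = G.edgeType e := by
  rw [edgeType, edgeType, h.1, h.2]

theorem bijOn_val_between_edgeSub {t : Prop × Cardinal.{u}}
    {hS : ∀ e ∈ G.edgeType ⁻¹' {t}, G.inv e ∈ G.edgeType ⁻¹' {t}}
    (e : (G.edgeSub (G.edgeType ⁻¹' {t}) hS).E) :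
    Set.BijOn (fun e' => e'.1) ((G.edgeSub _ hS).between (MGraph.init _ e) (MGraph.term _ e))
      (G.between (G.init e.1) (G.term e.1)) :=
  ⟨fun _ h => h, Subtype.val_injective.injOn,
    fun e' h => ⟨⟨e', (edgeType_eq_of_mem_between h).trans e.2⟩, h, rfl⟩⟩

theorem VertexTransitive.colourable_of_mk_between [Countable G.V] (hG : G.VertexTransitive)
    (hloop : ∀ e, G.init e ≠ G.term e) {L : Type*}
    (hL : ∀ e, Nonempty (G.between (G.init e) (G.term e) ≃ L)) : G.Colourable := by
  obtain ⟨label, label_inv, hlabel⟩ := exists_labelling hloop hL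
  exact (colourable_ofSimpleGraph hG.toSimpleGraph).of_hom (homOfSimpleGraph hloop)
    Function.bijective_id label label_inv hlabel

theorem VertexTransitive.colourable [Countable G.V] (hG : G.VertexTransitive) : G.Colourable := by
  refine colourable_of_partition G.edgeType edgeType_inv fun ⟨isLoop, κ⟩ => ?_
  have hsub := hG.edgeSub (S := G.edgeType ⁻¹' {(isLoop, κ)})
    (fun e he => (edgeType_inv e).trans he) fun f e => by
      rw [Set.mem_preimage, f.edgeType_onE, Set.mem_preimage]
  obtain rfl | rfl := Classical.propComplete isLoop
  · exact hsub.colourable_of_loops fun e => of_eq_true (congrArg Prod.fst e.2)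
  · have : Countable (G.edgeSub (G.edgeType ⁻¹' {(False, κ)})
      fun e he => (edgeType_inv e).trans he).V := ‹Countable G.V›
    refine hsub.colourable_of_mk_between (fun e => of_eq_false (congrArg Prod.fst e.2))
      (L := κ.out) fun e => ?_
    rw [← Cardinal.eq, Cardinal.mk_out, Cardinal.mk_congr ((bijOn_val_between_edgeSub e).equiv _)]
    exact congrArg Prod.snd e.2

end MGraph

theorem Letter.inv_inv {U I : Type u} (l : Letter U I) : l.inv.inv = l := by
  cases l <;> rfl

theorem exists_equiv_letter {K : Type u} {ι : K → K} (hι : Function.Involutive ι) :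
    ∃ (U I : Type u) (f : K ≃ Letter U I), ∀ k, f (ι k) = (f k).inv := by
  classical
  let : LinearOrder K := IsWellOrder.linearOrder WellOrderingRel
  let ofLetter : Letter {k // k < ι k} {k // ι k = k} → K
    | .pos k => k
    | .neg k => ι k
    | .invol k => k
  let toLetter (k : K) : Letter {k // k < ι k} {k // ι k = k} :=
    if h : k < ι k then .pos ⟨k, h⟩
    else if h' : ι k < k then .neg ⟨ι k, (hι k).symm ▸ h'⟩
    else .invol ⟨k, (not_lt.1 h).antisymm (not_lt.1 h')⟩
  have toLetter_ofLetter : Function.LeftInverse toLetter ofLetter := by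
    rintro (⟨k, hk⟩ | ⟨k, hk⟩ | ⟨k, hk⟩)
    · simp only [toLetter, ofLetter, dif_pos hk]
    · simp only [toLetter, ofLetter, hι k, dif_pos hk, dif_neg hk.not_gt]
    · simp only [toLetter, ofLetter, hk, lt_irrefl, dite_false]
  have ofLetter_toLetter : Function.RightInverse toLetter ofLetter := by
    intro k
    simp only [toLetter]
    split_ifs
    exacts [rfl, hι k, rfl]
  have ofLetter_inv : ∀ l, ofLetter l.inv = ι (ofLetter l)
    | .pos _ => rfl
    | .neg k => (hι k).symm
    | .invol k => k.2.symm
  refine ⟨_, _, ⟨toLetter, ofLetter, ofLetter_toLetter, toLetter_ofLetter⟩, fun k => ?_⟩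
  rw [Equiv.coe_fn_mk, ← toLetter_ofLetter (toLetter k).inv, ofLetter_inv, ofLetter_toLetter k]

namespace MGraph

variable {G : MGraph.{u}}

theorem IsColouring.involutive [Nonempty G.V] {K : Type*} {ι : K → K} {col : G.E → K}
    (h : G.IsColouring ι col) : Function.Involutive ι := by
  intro k
  obtain ⟨e, he⟩ := h.bijective.2 (Classical.arbitrary G.V, k)
  obtain rfl : col e = k := congrArg Prod.snd he
  rw [← h.col_inv, ← h.col_inv, G.inv_inv]

theorem Colourable.exists_isColouring_inv [Nonempty G.V] (h : G.Colourable) :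
    ∃ (U I : Type u) (col : G.E → Letter U I), G.IsColouring Letter.inv col := by
  obtain ⟨K, ι, col, hcol⟩ := h
  obtain ⟨U, I, f, hf⟩ := exists_equiv_letter hcol.involutive
  refine ⟨U, I, f ∘ col, fun e => ?_, ?_⟩
  · exact (congrArg f (hcol.col_inv e)).trans (hf (col e))
  · exact (Function.bijective_id.prodMap f.bijective).comp hcol.bijective

namespace IsColouring

variable {U I : Type u} {col : G.E → Letter U I} (h : G.IsColouring Letter.inv col)

/-- The terminus of the edge of colour `l` that starts at `x`. -/
noncomputable def next (x : G.V) (l : Letter U I) : G.V :=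
  G.term ((Equiv.ofBijective _ h.bijective).symm (x, l))

theorem next_init_col (e : G.E) : h.next (G.init e) (col e) = G.term e :=
  congrArg G.term ((Equiv.ofBijective _ h.bijective).symm_apply_apply e)

theorem next_next_inv (x : G.V) (l : Letter U I) : h.next (h.next x l) l.inv = x := by
  obtain ⟨e, he⟩ := h.bijective.2 (x, l)
  obtain ⟨rfl, rfl⟩ := Prod.mk.inj he
  rw [next_init_col, ← h.col_inv, ← init_inv, next_init_col, term_inv]

theorem next_invol_ne (x : G.V) (i : I) : h.next x (.invol i) ≠ x := by
  obtain ⟨e, he⟩ := h.bijective.2 (x, .invol i)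
  obtain ⟨rfl, hcol⟩ := Prod.mk.inj he
  rw [← hcol, next_init_col]
  refine fun hloop => G.inv_ne e (h.bijective.1 (Prod.ext ((init_inv e).trans hloop) ?_))
  change col (G.inv e) = col e
  rw [h.col_inv, hcol]
  rfl

/-- The permutation of the vertices given by the edges of colour `l`. -/
noncomputable def perm (l : Letter U I) : Equiv.Perm G.V where
  toFun x := h.next x l
  invFun x := h.next x l.inv
  left_inv x := h.next_next_inv x l
  right_inv x := by
    have := h.next_next_inv x l.inv
    rwa [l.inv_inv] at this

/-- The map `φ` of the partite presentation given by a colouring. -/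
noncomputable def generator : U ⊕ I → Equiv.Perm G.V :=
  Sum.elim (fun s => h.perm (.pos s)) fun s => h.perm (.invol s)

theorem generator_inr_sq (i : I) : h.generator (Sum.inr i) ^ 2 = 1 :=
  Equiv.ext fun x => h.next_next_inv x (.invol i)

theorem action_toMF (l : Letter U I) :
    (action h.generator h.generator_inr_sq l.toMF).unop = h.perm l := by
  cases l with
  | neg s =>
    rw [action, Letter.toMF, map_inv, PresentedGroup.toGroup.of]
    rfl
  | pos s | invol s =>
    rw [action, Letter.toMF, PresentedGroup.toGroup.of]
    rfl

theorem exists_action_eq_endpoint {x : G.V} {p : List G.E} (hp : G.IsWalk x p) :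
    ∃ w, (action h.generator h.generator_inr_sq w).unop x = G.endpoint x p := by
  induction p generalizing x with
  | nil => exact ⟨1, by rw [map_one]; rfl⟩
  | cons e p ih =>
    obtain ⟨rfl, hp⟩ := hp
    obtain ⟨w, hw⟩ := ih hp
    refine ⟨(col e).toMF * w, ?_⟩
    rw [map_mul, MulOpposite.unop_mul, Equiv.Perm.mul_apply, action_toMF]
    exact (congrArg _ (h.next_init_col e)).trans hw

/-- The partite presentation given by a colouring of a connected graph, with all closed walks as
relators. -/
noncomputable def presentation (hG : G.Connected) : PartitePresentation.{u} where
  X := G.V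
  U := U
  I := I
  φ := h.generator
  nonempty := hG.1
  sq_eq_one := h.generator_inr_sq
  fixedPointFree i x := h.next_invol_ne x i
  transitive x y := by
    obtain ⟨p, hp, rfl⟩ := hG.2 x y
    exact h.exists_action_eq_endpoint hp
  R x := {w | (action h.generator h.generator_inr_sq w).unop x = x}
  stab _ _ hw := hw

theorem perm_presentation (hG : G.Connected) (l : Letter U I) :
    (h.presentation hG).perm l = h.perm l := by
  cases l <;> rfl

/-- The identification of a coloured graph with the presentation graph of its presentation. -/
noncomputable def isoPresentation (hG : G.Connected) : Iso G (h.presentation hG).graph where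
  onV := id
  onE e := (G.init e, col e)
  map_inv e := by
    refine Prod.ext ?_ (h.col_inv e)
    change G.init (G.inv e) = (h.presentation hG).perm (col e) (G.init e)
    rw [perm_presentation, init_inv]
    exact (h.next_init_col e).symm
  map_term e := by
    change G.term e = (h.presentation hG).perm (col e) (G.init e)
    rw [perm_presentation]
    exact (h.next_init_col e).symm
  bijective_onV := Function.bijective_id
  bijective_onE := h.bijective

end IsColouring

theorem Colourable.exists_presentation (h : G.Colourable) (hG : G.Connected) :
    ∃ P : PartitePresentation.{u}, Nonempty (Iso G P.graph) ∧
      ∀ x w, (action P.φ P.sq_eq_one w).unop x = x → w ∈ P.R x := by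
  have := hG.1
  obtain ⟨U, I, col, hcol⟩ := h.exists_isColouring_inv
  exact ⟨hcol.presentation hG, ⟨hcol.isoPresentation hG⟩, fun _ _ hw => hw⟩

end MGraph

namespace MGraph

variable {G H K : MGraph.{u}}

theorem Hom.isWalk_map (f : Hom G H) {x : G.V} {p : List G.E} (hp : G.IsWalk x p) :
    H.IsWalk (f.onV x) (p.map f.onE) := by
  induction p generalizing x with
  | nil => trivial
  | cons e p ih =>
    obtain ⟨rfl, hp⟩ := hp
    exact ⟨(f.map_init e).symm, f.map_term e ▸ ih hp⟩

theorem Hom.endpoint_map (f : Hom G H) (x : G.V) (p : List G.E) :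
    H.endpoint (f.onV x) (p.map f.onE) = f.onV (G.endpoint x p) := by
  induction p generalizing x with
  | nil => rfl
  | cons e p ih =>
    rw [List.map_cons, endpoint, endpoint, ← f.map_term, ih]

theorem Iso.connected (f : Iso G H) (hG : G.Connected) : H.Connected := by
  refine ⟨hG.1.map f.onV, fun x y => ?_⟩
  obtain ⟨x, rfl⟩ := f.bijective_onV.2 x
  obtain ⟨y, rfl⟩ := f.bijective_onV.2 y
  obtain ⟨p, hp, rfl⟩ := hG.2 x y
  exact ⟨_, f.isWalk_map hp, f.endpoint_map x p⟩

/-- The composition of isomorphisms. -/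
def Iso.trans (f : Iso G H) (g : Iso H K) : Iso G K where
  onV := g.onV ∘ f.onV
  onE := g.onE ∘ f.onE
  map_inv e := by rw [Function.comp_apply, f.map_inv, g.map_inv, Function.comp_apply]
  map_term e := by rw [Function.comp_apply, f.map_term, g.map_term, Function.comp_apply]
  bijective_onV := g.bijective_onV.comp f.bijective_onV
  bijective_onE := g.bijective_onE.comp f.bijective_onE

/-- The inverse of an isomorphism. -/
noncomputable def Iso.symm (f : Iso G H) : Iso H G where
  onV := (Equiv.ofBijective _ f.bijective_onV).symm
  onE := (Equiv.ofBijective _ f.bijective_onE).symm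
  map_inv e := by
    obtain ⟨e, rfl⟩ := f.bijective_onE.2 e
    rw [← f.map_inv, Equiv.ofBijective_symm_apply_apply, Equiv.ofBijective_symm_apply_apply]
  map_term e := by
    obtain ⟨e, rfl⟩ := f.bijective_onE.2 e
    rw [← f.map_term, Equiv.ofBijective_symm_apply_apply, Equiv.ofBijective_symm_apply_apply]
  bijective_onV := Equiv.bijective _
  bijective_onE := Equiv.bijective _

end MGraph

namespace TwoComplex

variable {C : TwoComplex.{u}} {b : C.skeleton.V}

theorem endpoint_eq_of_homotopy {p q : C.WalkFrom b} (h : C.homotopy b p q) :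
    C.skeleton.endpoint b p.1 = C.skeleton.endpoint b q.1 :=
  congrArg (C.projV b) (Quotient.sound (s := C.homotopy b) h)

theorem homotopy_of_step {p q : C.WalkFrom b} (h : C.Step b p.1 q.1) : C.homotopy b p q :=
  Relation.EqvGen.rel _ _ h

theorem homotopy_of_endpoint_eq
    (hnull : ∀ p : C.WalkFrom b, C.skeleton.endpoint b p.1 = b → C.homotopy b p ⟨[], trivial⟩)
    (p q : C.WalkFrom b) (h : C.skeleton.endpoint b p.1 = C.skeleton.endpoint b q.1) :
    C.homotopy b p q := by
  obtain ⟨q, hq⟩ := q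
  induction q using List.reverseRecOn generalizing p with
  | nil => exact hnull p h
  | append_singleton q e ih =>
    obtain ⟨hq', he, -⟩ := (MGraph.isWalk_append _ _ _ _).1 hq
    have h : C.skeleton.init (C.skeleton.inv e) = C.skeleton.endpoint b p.1 := by
      rw [h, MGraph.endpoint_append, MGraph.init_inv]
      rfl
    have hback : C.skeleton.IsWalk b (p.1 ++ [C.skeleton.inv e]) :=
      (MGraph.isWalk_append _ _ _ _).2 ⟨p.2, h, trivial⟩
    have hend : C.skeleton.endpoint b (p.1 ++ [C.skeleton.inv e]) = C.skeleton.init e :=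
      MGraph.endpoint_append _ _ _ _
    have hforth : C.skeleton.IsWalk b (p.1 ++ [C.skeleton.inv e] ++ [e]) :=
      (MGraph.isWalk_append _ _ _ _).2 ⟨hback, hend.symm, trivial⟩
    have backtrack : C.Step b p.1 (p.1 ++ [C.skeleton.inv e] ++ [e]) := by
      simpa [C.skeleton.inv_inv] using Step.backtrack p.1 [] _ h
    exact (C.homotopy b).trans (homotopy_of_step (q := ⟨_, hforth⟩) backtrack)
      (C.homotopy_append (ih ⟨_, hback⟩ hq' (hend.trans he)) [e] hforth hq)

theorem nonempty_iso_universalCover (hC : C.skeleton.Connected)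
    (hnull : ∀ p : C.WalkFrom b, C.skeleton.endpoint b p.1 = b → C.homotopy b p ⟨[], trivial⟩) :
    Nonempty (MGraph.Iso (C.universalCover b).skeleton C.skeleton) := by
  have bijective_projV : Function.Bijective (C.projV b) := by
    refine ⟨fun v w hvw => ?_, (C.universalCoverProj_isCovering b hC).surjective⟩
    induction v, w using Quotient.inductionOn₂ with
    | _ p q => exact Quotient.sound (homotopy_of_endpoint_eq hnull p q hvw)
  refine ⟨⟨(C.universalCoverProj b).toHom, bijective_projV, ?_, fun e => ?_⟩⟩
  · rintro ⟨⟨v, e⟩, hv⟩ ⟨⟨w, e'⟩, hw⟩ (rfl : e = e')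
    obtain rfl : v = w := bijective_projV.1 (hv.symm.trans hw)
    rfl
  · obtain ⟨v, hv⟩ := bijective_projV.2 (C.skeleton.init e)
    exact ⟨⟨(v, e), hv.symm⟩, rfl⟩

end TwoComplex

namespace PartitePresentation

variable {P : PartitePresentation.{u}} {x : P.X}

theorem walk_append (x : P.X) (v w : List (Letter P.U P.I)) :
    P.walk x (v ++ w) = P.walk x v ++ P.walk (P.graph.endpoint x (P.walk x v)) w := by
  induction v generalizing x with
  | nil => rfl
  | cons s v ih => exact congrArg ((x, s) :: ·) (ih _)

theorem eq_walk {p : List P.graph.E} (hp : P.graph.IsWalk x p) :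
    p = P.walk x (p.map Prod.snd) := by
  induction p generalizing x with
  | nil => rfl
  | cons e p ih =>
    obtain ⟨y, s⟩ := e
    obtain ⟨hyx, hp⟩ := hp
    obtain rfl : y = x := (P.perm_inv s y).symm.trans hyx
    exact congrArg ((y, s) :: ·) (ih hp)

/-- The homotopy class of the walk from `x` dictated by the word `w`. -/
def walkClass (x : P.X) (w : List (Letter P.U P.I)) : P.complex.CoverV x :=
  Quotient.mk (P.complex.homotopy x) ⟨P.walk x w, P.isWalk_walk x w⟩

theorem walkClass_append {v w : List (Letter P.U P.I)} (h : walkClass x v = walkClass x w)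
    (u : List (Letter P.U P.I)) : walkClass x (v ++ u) = walkClass x (w ++ u) := by
  have hvw := Quotient.exact h
  have hv := P.isWalk_walk x (v ++ u)
  have hw := P.isWalk_walk x (w ++ u)
  refine Quotient.sound (s := P.complex.homotopy x) ?_
  have hend := TwoComplex.endpoint_eq_of_homotopy hvw
  simp only [walk_append, hend] at hv hw ⊢
  exact P.complex.homotopy_append hvw _ hv hw

theorem walkClass_cancel (v : List (Letter P.U P.I)) (s : Letter P.U P.I) :
    walkClass x (v ++ [s] ++ [s.inv]) = walkClass x v := by
  refine (Quotient.sound (s := P.complex.homotopy x) (TwoComplex.homotopy_of_step ?_)).symm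
  simpa [walk_append, walk, MGraph.endpoint_append] using
    TwoComplex.Step.backtrack (C := P.complex) (x := x) (P.walk x v) []
      (P.graph.endpoint x (P.walk x v), s) (P.perm_inv s _)

theorem exists_reduced_walkClass_eq (w : List (Letter P.U P.I)) :
    ∃ v, Letter.Reduced v ∧ walkClass x v = walkClass x w := by
  induction w using List.reverseRecOn with
  | nil => exact ⟨[], List.isChain_nil, rfl⟩
  | append_singleton w s ih =>
    obtain ⟨v, hv, hvw⟩ := ih
    rw [← walkClass_append hvw [s]]
    induction v using List.reverseRecOn with
    | nil => exact ⟨[s], List.isChain_singleton s, rfl⟩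
    | append_singleton v t _ =>
      obtain rfl | hs := eq_or_ne s t.inv
      · exact ⟨v, (List.isChain_append.1 hv).1, (walkClass_cancel v t).symm⟩
      · refine ⟨_, List.isChain_append.2 ⟨hv, List.isChain_singleton s, ?_⟩, rfl⟩
        simpa using hs

theorem homotopy_nil_of_stabilizer_subset
    (hR : ∀ x w, (action P.φ P.sq_eq_one w).unop x = x → w ∈ P.R x)
    (p : P.complex.WalkFrom x) (hp : P.graph.endpoint x p.1 = x) :
    P.complex.homotopy x p ⟨[], trivial⟩ := by
  obtain ⟨p, hwalk⟩ := p
  obtain ⟨w, rfl⟩ : ∃ w, p = P.walk x w := ⟨_, eq_walk hwalk⟩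
  obtain ⟨v, hv, hvw⟩ := exists_reduced_walkClass_eq (x := x) w
  have hvw := Quotient.exact hvw
  have relator : (v.map Letter.toMF).prod ∈ P.R x :=
    hR _ _ ((P.endpoint_walk x v).symm.trans
      ((TwoComplex.endpoint_eq_of_homotopy hvw).trans hp))
  have cell : P.complex.Step x [] (P.walk x v) := by
    simpa using TwoComplex.Step.cell (C := P.complex) (x := x) [] [] ⟨(x, v), hv, relator⟩ rfl
  exact (P.complex.homotopy x).trans ((P.complex.homotopy x).symm hvw)
    ((P.complex.homotopy x).symm (TwoComplex.homotopy_of_step cell))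

end PartitePresentation

end Partite

theorem theorem1p1 (Γ : Partite.MGraph.{u}) (hcount : Countable Γ.V) (hconn : Γ.Connected)
    (htrans : Γ.VertexTransitive) :
    ∃ P : Partite.PartitePresentation.{u}, ∀ b : P.X,
      Nonempty (Partite.MGraph.Iso Γ (P.cayleyGraph b)) := by
  obtain ⟨P, ⟨f⟩, hR⟩ := htrans.colourable.exists_presentation hconn
  refine ⟨P, fun b => ?_⟩
  obtain ⟨g⟩ := Partite.TwoComplex.nonempty_iso_universalCover (b := b) (f.connected hconn)
    (Partite.PartitePresentation.homotopy_nil_of_stabilizer_subset hR)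
  exact ⟨f.trans g.symm⟩
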